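/- **Setting.** Let $(\nu_a)_{a\in\mathcal M}$ be a canonical one-parameter exponential family on $\mathbb R$ parametrized by its mean: its members are the laws $\propto e^{\theta x}\rho(dx)$, with $\theta$ in an open interval on which $\int e^{\theta x}\rho(dx)<\infty$, where $\rho$ is not concentrated at one point, and $\mathcal M$ is the set of their means. Write $d(a,b)=\mathrm{KL}(\nu_a,\nu_b)$, and let $d_B(p,q)$ be the Kullback–Leibler divergence between Bernoulli laws of means $p,q$. Let $K\ge 2$ and $\gamma\in\mathcal M$. For $\lambda\in\mathcal M^K$ put $\lambda_\star=\min_k\lambda_k$; we consider the set $\mathcal L$ of those $\lambda\in\mathcal M^K$ for which $\arg\min_k\lambda_k$ is a single slice and $\lambda_\star\ne\gamma$. The least-loaded-slice criterion has the set of correct answers $\mathcal C(\lambda)=\arg\min_k\lambda_k$ if $\lambda_\star<\gamma$, and $\mathcal C(\lambda)=\{0\}$ (reject) otherwise. Under $\mathbb P_\lambda$ the variables $X_k(t)$ ($1\le k\le K$, $t\ge1$) are independent with $X_k(t)\sim\nu_{\lambda_k}$. An algorithm selects in each slot $t$ a slice $k_t$ that is $\mathcal F_{t-1}$-measurable, where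 $\mathcal F_t=\sigma(k_1,X_{k_1}(1),\dots,k_t,X_{k_t}(t))$; it stops at a stopping time $\tau$ of $(\mathcal F_t)$ and returns an $\mathcal F_\tau$-measurable decision $\hat k\in\{0,1,\dots,K\}$. It is $\delta$-PC if $\mathbb P_\lambda[\tau<\infty]=1$ and $\mathbb P_\lambda[\hat k\notin\mathcal C(\lambda)]\le\delta$ for every $\lambda\in\mathcal L$. For $\mu\in\mathcal L$ and $j\neq k$ with $\mu_j\ne\mu_k$ put, for $x\ge0$, $$g_{j,k}(x)=d\Big(\mu_k,\tfrac{\mu_k+x\mu_j}{1+x}\Big)+x\,d\Big(\mu_j,\tfrac{\mu_k+x\mu_j}{1+x}\Big),$$ let $x_{j,k}=g_{j,k}^{-1}$ be its inverse, let $x_{k,k}\equiv1$ by convention, and let $$F_k(y;S)=\sum_{j\in S}\frac{d\big(\mu_k,(\mu_k+x_{j,k}(y)\mu_j)/(1+x_{j,k}(y))\big)}{d\big(\mu_j,(\mu_k+x_{j,k}(y)\mu_j)/(1+x_{j,k}(y))\big)} .$$ **Proposition (least-loaded slice).** Let $\mu\in\mathcal L$ with $\mathcal C(\mu)\neq\{0\}$,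 let $k_\star$ be the least loaded slice, $\mu_\star=\mu_{k_\star}$ and $\mathcal S_{LL}=\{j:\mu_j>\mu_\star\}$. The equation $F_{k_\star}(y;\mathcal S_{LL})=1$ has a unique solution $y_\star$ (among the $y$ at which all $x_{j,k_\star}$, $j\in\mathcal S_{LL}$, are defined). Put $$z_\star=\min(d(\mu_\star,\gamma),y_\star),\qquad T_3(\mu)=\frac1{z_\star}\sum_{k=1}^K x_{k,k_\star}(z_\star),\qquad w^\star_k(\mu)=\frac{x_{k,k_\star}(z_\star)}{z_\star T_3(\mu)} .$$ Then for every $\delta\in(0,1/2]$ every $\delta$-PC algorithm satisfies $$\mathbb E_\mu[\tau]\ \ge\ T_3(\mu)\,d_B(\delta,1-\delta).$$ Moreover $w^\star(\mu)$ is the optimal measurement process: it lies in the simplex $\Lambda=\{w\in[0,1]^K:\sum_kw_k=1\}$ and is the unique maximizer over $w\in\Lambda$ of $$\inf_{\lambda\in\mathcal L:\ k_\star\notin\mathcal C(\lambda)}\ \sum_{k=1}^K w_k\,d(\mu_k,\lambda_k),$$ and the maximal value is $T_3(\mu)^{-1}$. -/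

import Mathlib

open MeasureTheory ProbabilityTheory

noncomputable section

/-- A (canonical) one-parameter exponential family on `ℝ`: the laws
`dν_θ(x) = exp (θ x - b(θ)) dρ(x)`, where the natural parameter `θ` ranges over an open interval
on which the normalizing integral converges, and the reference measure `ρ` is not concentrated
at one point. -/
structure ExpFamily where
  ρ : Measure ℝ
  Θ : Set ℝ
  isOpen_Θ : IsOpen Θ
  ordConnected_Θ : Θ.OrdConnected
  integrable_exp : ∀ θ ∈ Θ, Integrable (fun x : ℝ => Real.exp (θ * x)) ρ
  nondegenerate : ∀ c : ℝ, ρ {c}ᶜ ≠ 0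

namespace ExpFamily

variable (E : ExpFamily)

/-- The law with natural parameter `θ`: density `exp (θ x) / ∫ exp (θ x) dρ` w.r.t. `ρ`. -/
def natLaw (θ : ℝ) : Measure ℝ := E.ρ.tilted (fun x => θ * x)

/-- The mean of the law with natural parameter `θ`. -/
def mean (θ : ℝ) : ℝ := ∫ x, x ∂(E.natLaw θ)

/-- The set of means of the laws of the family. -/
def means : Set ℝ := E.mean '' E.Θ

/-- The natural parameter in `Θ` of the law with mean `a`, for `a ∈ E.means`. -/
def natParam (a : ℝ) : ℝ := Function.invFunOn E.mean E.Θ a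

open Classical in
/-- The law of the family with mean `a`, for `a ∈ E.means`. (Outside of `E.means` there is no such
law; a point mass is put there only so that the value is always a probability measure.) -/
def law (a : ℝ) : Measure ℝ :=
  if a ∈ E.means then E.natLaw (E.natParam a) else Measure.dirac a

instance isProbabilityMeasure_law (a : ℝ) : IsProbabilityMeasure (E.law a) := by
  unfold law
  split_ifs with h
  · have hmem : E.natParam a ∈ E.Θ := Function.invFunOn_mem h
    have : NeZero E.ρ := ⟨fun h0 => E.nondegenerate 0 (by simp [h0])⟩
    exact isProbabilityMeasure_tilted (E.integrable_exp _ hmem)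
  · infer_instance

/-- `d(a, b)`: the Kullback-Leibler divergence between the laws with means `a` and `b`. -/
def d (a b : ℝ) : ℝ := (InformationTheory.klDiv (E.law a) (E.law b)).toReal

end ExpFamily

/-- `d_B(p, q)`: the Kullback-Leibler divergence between the Bernoulli laws with means `p`, `q`. -/
def bernoulliKL (p q : unitInterval) : ℝ :=
  (InformationTheory.klDiv (bernoulliMeasure (1 : ℝ) 0 p) (bernoulliMeasure (1 : ℝ) 0 q)).toReal

/-- Correct answers for the least-loaded-slice criterion with loads `l` and threshold `γ`.
`some k` means "admit on slice `k`", `none` means "reject". -/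
def correctAnswers {K : ℕ} (γ : ℝ) (l : Fin K → ℝ) : Set (Option (Fin K)) :=
  {a | match a with
    | none => ∀ k, γ ≤ l k
    | some k => l k < γ ∧ ∀ j, l k ≤ l j}

/-- The load vectors under consideration: every load is a mean of the family, the least loaded
slice is unique, and the smallest load differs from the threshold. -/
def loadModels (E : ExpFamily) (K : ℕ) (γ : ℝ) : Set (Fin K → ℝ) :=
  {l | (∀ k, l k ∈ E.means) ∧ (∃! k, ∀ j, l k ≤ l j) ∧ ∀ k, (∀ j, l k ≤ l j) → l k ≠ γ}

/-! ### Measurement and decision algorithms -/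

/-- Outcomes: `ω t k` is the number of packets `X_k(t+1)` of slice `k` in slot `t + 1`
(slots are counted from `0` here). -/
abbrev Outcome (K : ℕ) : Type := ℕ → Fin K → ℝ

/-- The distribution `ℙ_l` of the outcomes: all `X_k(t)` are independent, and `X_k(t)` has the
law of the family with mean `l k`. -/
def outcomeMeasure (E : ExpFamily) {K : ℕ} (l : Fin K → ℝ) : Measure (Outcome K) :=
  Measure.infinitePi fun _ : ℕ => Measure.pi fun k : Fin K => E.law (l k)

/-- The slice measured in slot `s`, together with the value observed there. -/
def observation {K : ℕ} (slice : ℕ → Outcome K → Fin K) (s : ℕ) (ω : Outcome K) : Fin K × ℝ :=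
  (slice s ω, ω s (slice s ω))

/-- The `σ`-algebra generated by the first `t` observations. -/
@[reducible] def history {K : ℕ} (slice : ℕ → Outcome K → Fin K) (t : ℕ) : MeasurableSpace (Outcome K) :=
  ⨆ s : Fin t, MeasurableSpace.comap (observation slice s) inferInstance

theorem history_le {K : ℕ} (slice : ℕ → Outcome K → Fin K)
    (h : ∀ t, Measurable[history slice t] (slice t)) (t : ℕ) :
    history slice t ≤ (inferInstance : MeasurableSpace (Outcome K)) := by
  induction t using Nat.strong_induction_on with
  | _ t ih =>
    refine iSup_le fun s => ?_
    have hs : Measurable (slice s) := (h s).mono (ih s s.2) le_rfl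
    have he : Measurable (fun p : Fin K × (Fin K → ℝ) => p.2 p.1) :=
      measurable_from_prod_countable_right fun k => measurable_pi_apply k
    have hv : Measurable (fun ω : Outcome K => ω s (slice s ω)) :=
      he.comp (hs.prodMk (measurable_pi_apply (s : ℕ)))
    exact (hs.prodMk hv).comap_le

/-- The filtration of the observations. -/
def historyFiltration {K : ℕ} (slice : ℕ → Outcome K → Fin K)
    (h : ∀ t, Measurable[history slice t] (slice t)) :
    Filtration ℕ (inferInstance : MeasurableSpace (Outcome K)) where
  seq := history slice
  mono' := fun _ t hst => iSup_le fun i =>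
    le_iSup (fun j : Fin t => MeasurableSpace.comap (observation slice j) inferInstance)
      (Fin.castLE hst i)
  le' := history_le slice h

/-- A joint measurement and decision algorithm: a sampling strategy (the slice measured next is a
measurable function of the past observations), a stopping time for the filtration of the
observations, and a decision that is measurable for the `σ`-algebra of the stopping time. -/
structure Algorithm (K : ℕ) where
  slice : ℕ → Outcome K → Fin K
  measurable_slice : ∀ t, Measurable[history slice t] (slice t)
  τ : Outcome K → ℕ∞
  isStoppingTime : IsStoppingTime (historyFiltration slice measurable_slice) τ
  decision : Outcome K → Option (Fin K)
  measurable_decision : Measurable[isStoppingTime.measurableSpace, ⊤] decision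

namespace Algorithm

variable {K : ℕ} (A : Algorithm K)

/-- `δ`-probably correct algorithms. -/
def IsPC (E : ExpFamily) (γ δ : ℝ) : Prop :=
  ∀ l ∈ loadModels E K γ,
    outcomeMeasure E l {ω | A.τ ω < ⊤} = 1 ∧
    outcomeMeasure E l {ω | A.decision ω ∉ correctAnswers γ l} ≤ ENNReal.ofReal δ

/-- The sample complexity `𝔼_l[τ]`. -/
def sampleComplexity (E : ExpFamily) (l : Fin K → ℝ) : ENNReal :=
  ∫⁻ ω, (A.τ ω : ENNReal) ∂(outcomeMeasure E l)

end Algorithm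

/-! ### The quantities in the lower bound -/

/-- The load vectors for which `a` is not a correct answer. -/
def alternatives (E : ExpFamily) (K : ℕ) (γ : ℝ) (a : Option (Fin K)) : Set (Fin K → ℝ) :=
  {l | l ∈ loadModels E K γ ∧ a ∉ correctAnswers γ l}

/-- `inf_l ∑ k, w_k d(μ_k, l_k)` over the load vectors `l` for which `a` is not correct. -/
def informationRate (E : ExpFamily) {K : ℕ} (γ : ℝ) (μ : Fin K → ℝ) (a : Option (Fin K))
    (w : Fin K → ℝ) : ℝ :=
  ⨅ l : alternatives E K γ a, ∑ k, w k * E.d (μ k) (l.1 k)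

/-- `(μ_k + x μ_j) / (1 + x)`. -/
def mixedMean {K : ℕ} (μ : Fin K → ℝ) (j k : Fin K) (x : ℝ) : ℝ := (μ k + x * μ j) / (1 + x)

/-- The information deviation function `g_{j,k}`, a function on `[0, ∞)`. -/
def deviation (E : ExpFamily) {K : ℕ} (μ : Fin K → ℝ) (j k : Fin K) (x : ℝ) : ℝ :=
  E.d (μ k) (mixedMean μ j k x) + x * E.d (μ j) (mixedMean μ j k x)

/-- `x_{j,k}`, the inverse of `g_{j,k} : [0, ∞) → ℝ`, with the convention `x_{k,k} = 1`
(`g_{k,k}` vanishes identically and has no inverse). -/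
def deviationInv (E : ExpFamily) {K : ℕ} (μ : Fin K → ℝ) (j k : Fin K) (y : ℝ) : ℝ :=
  if j = k then 1 else Function.invFunOn (deviation E μ j k) (Set.Ici 0) y

/-- The equilibrium function `F_k(y; S)`. -/
def equilibrium (E : ExpFamily) {K : ℕ} (μ : Fin K → ℝ) (k : Fin K) (S : Finset (Fin K))
    (y : ℝ) : ℝ :=
  ∑ j ∈ S, E.d (μ k) (mixedMean μ j k (deviationInv E μ j k y)) /
    E.d (μ j) (mixedMean μ j k (deviationInv E μ j k y))

/-- `y` solves `F_k(y; S) = 1`: every `x_{j,k}(y)`, `j ∈ S`, is defined and the equation holds. -/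
def IsEquilibrium (E : ExpFamily) {K : ℕ} (μ : Fin K → ℝ) (k : Fin K) (S : Finset (Fin K))
    (y : ℝ) : Prop :=
  (∀ j ∈ S, y ∈ deviation E μ j k '' Set.Ici 0) ∧ equilibrium E μ k S y = 1

/-- The slices with a load larger than that of `k`. -/
def moreLoaded {K : ℕ} (μ : Fin K → ℝ) (k : Fin K) : Finset (Fin K) :=
  Finset.univ.filter fun j => μ k < μ j

/-- `T = (1 / z) ∑ k, x_{k,k₀}(z)`. -/
def characteristicTime (E : ExpFamily) {K : ℕ} (μ : Fin K → ℝ) (k₀ : Fin K) (z : ℝ) : ℝ :=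
  (1 / z) * ∑ k, deviationInv E μ k k₀ z

/-- `w_k = x_{k,k₀}(z) / (z T)`. -/
def proportions (E : ExpFamily) {K : ℕ} (μ : Fin K → ℝ) (k₀ : Fin K) (z : ℝ) : Fin K → ℝ :=
  fun k => deviationInv E μ k k₀ z / (z * characteristicTime E μ k₀ z)

end

/-!
Fix a candidate slice `k₀`. If `m` is the mixture of `a` and `b` with weights `u` and `v`, then
`u d(a, c) + v d(b, c) = u d(a, m) + v d(b, m) + (u + v) d(m, c)`. Hence the cheapest
alternatives to the answer `k₀` either raise its load to `γ`, or move `k₀` and one other slice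
`j` to a common load. At the level `z` these two kinds of constraints on the measurement counts
`w`, with multipliers `(1 - F z) / z` and `1 / d(μ j, m j)`, where `m j` is the critical common
load, add up to `r T ≤ ∑ w` for every `w` with information rate `r`: the counts `x_{j,k₀}(z)`
attain equality, and the term `(u + v) d(m, c)` of the identity above makes them the only ones
that do, up to scaling.

For the lower bound on the stopping time `τ`, change the measure at the bounded stopping time
`min τ n`. The expected log-likelihood ratio of `μ` and `λ` is `∑ k, E[N k] d(μ k, λ k)`, where
`N k` counts the measurements of slice `k`, and for an event `C` known at that time the
Donsker–Varadhan inequality bounds it below by `c P_μ(C) - log (1 + (exp c - 1) P_λ(C))`. Taking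
for `C` the event that `k₀` has been returned, the infimum over `λ` bounds the information rate
of the expected counts below; weak duality turns this into a bound on their sum, and it remains
to let `n → ∞` and to optimize over `c`.
-/

section Tilted

variable {α : Type*} {mα : MeasurableSpace α} {ν : Measure α} [IsProbabilityMeasure ν] {f : α → ℝ}

theorem llr_tilted_left_self_ae_eq (hf : Integrable (fun x => Real.exp (f x)) ν) :
    llr (ν.tilted f) ν =ᵐ[ν.tilted f] fun x => f x - Real.log (∫ x, Real.exp (f x) ∂ν) :=
  (tilted_absolutelyContinuous ν f).ae_le (log_rnDeriv_tilted_left_self hf)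

theorem klDiv_tilted_left_self_ne_top (hf : Integrable (fun x => Real.exp (f x)) ν)
    (hfi : Integrable f (ν.tilted f)) : InformationTheory.klDiv (ν.tilted f) ν ≠ ⊤ := by
  have := isProbabilityMeasure_tilted hf
  exact InformationTheory.klDiv_ne_top (tilted_absolutelyContinuous ν f)
    ((hfi.sub (integrable_const _)).congr (llr_tilted_left_self_ae_eq hf).symm)

theorem toReal_klDiv_tilted_left_self (hf : Integrable (fun x => Real.exp (f x)) ν)
    (hfi : Integrable f (ν.tilted f)) :
    (InformationTheory.klDiv (ν.tilted f) ν).toReal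
      = ∫ x, f x ∂(ν.tilted f) - Real.log (∫ x, Real.exp (f x) ∂ν) := by
  have := isProbabilityMeasure_tilted hf
  rw [InformationTheory.toReal_klDiv_of_measure_eq (tilted_absolutelyContinuous ν f) (by simp),
    integral_congr_ae (llr_tilted_left_self_ae_eq hf), integral_sub hfi (integrable_const _)]
  simp

end Tilted

namespace ExpFamily

variable {E : ExpFamily} {θ η a b c m u v : ℝ}

instance neZero_ρ : NeZero E.ρ := ⟨fun h => E.nondegenerate 0 (by simp [h])⟩

/-- The log-partition function `b(θ) = log ∫ exp (θ x) dρ` of the family. -/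
noncomputable def logPartition (E : ExpFamily) (θ : ℝ) : ℝ := cgf id E.ρ θ

theorem isProbabilityMeasure_natLaw (hθ : θ ∈ E.Θ) : IsProbabilityMeasure (E.natLaw θ) :=
  isProbabilityMeasure_tilted (E.integrable_exp _ hθ)

theorem mem_interior_integrableExpSet (hθ : θ ∈ E.Θ) :
    θ ∈ interior (integrableExpSet id E.ρ) :=
  interior_maximal (fun _ ht => E.integrable_exp _ ht) E.isOpen_Θ hθ

theorem integrable_id_natLaw (hθ : θ ∈ E.Θ) : Integrable (fun x => x) (E.natLaw θ) :=
  memLp_one_iff_integrable.1 (memLp_tilted_mul (X := id) (mem_interior_integrableExpSet hθ) 1)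

theorem continuousOn_logPartition : ContinuousOn E.logPartition E.Θ := fun _ hθ =>
  (analyticAt_cgf (mem_interior_integrableExpSet hθ)).continuousAt.continuousWithinAt

theorem mean_eq_deriv_logPartition (hθ : θ ∈ E.Θ) : E.mean θ = deriv E.logPartition θ :=
  integral_tilted_mul_self (X := id) (mem_interior_integrableExpSet hθ)

theorem continuousOn_mean : ContinuousOn E.mean E.Θ :=
  ContinuousOn.congr (fun _ hθ => (analyticAt_cgf
    (mem_interior_integrableExpSet hθ)).deriv.continuousAt.continuousWithinAt)
    fun _ hθ => mean_eq_deriv_logPartition hθ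

theorem natLaw_eq_tilted (θ : ℝ) (hη : η ∈ E.Θ) :
    E.natLaw θ = (E.natLaw η).tilted (fun x => (θ - η) * x) := by
  rw [natLaw, natLaw, tilted_tilted (E.integrable_exp _ hη)]
  congr 1 with x
  simp only [Pi.add_apply]
  ring

theorem integrable_exp_sub_mul (hθ : θ ∈ E.Θ) (hη : η ∈ E.Θ) :
    Integrable (fun x => Real.exp ((θ - η) * x)) (E.natLaw η) := by
  rw [natLaw, integrable_tilted_iff (E.integrable_exp _ hη)]
  refine (E.integrable_exp _ hθ).congr (Filter.Eventually.of_forall fun x => ?_)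
  simp only [smul_eq_mul, ← Real.exp_add]
  congr 1
  ring

theorem log_integral_exp_sub_mul (hθ : θ ∈ E.Θ) (hη : η ∈ E.Θ) :
    Real.log (∫ x, Real.exp ((θ - η) * x) ∂(E.natLaw η)) = E.logPartition θ - E.logPartition η := by
  have hadd : (fun x : ℝ => η * x) + (fun x => (θ - η) * x) = fun x => θ * x := by
    ext x
    simp only [Pi.add_apply]
    ring
  rw [natLaw, integral_exp_tilted, hadd, Real.log_div
    (integral_exp_pos (E.integrable_exp _ hθ)).ne' (integral_exp_pos (E.integrable_exp _ hη)).ne']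
  rfl

theorem klDiv_natLaw_ne_top (hθ : θ ∈ E.Θ) (hη : η ∈ E.Θ) :
    InformationTheory.klDiv (E.natLaw θ) (E.natLaw η) ≠ ⊤ := by
  have := isProbabilityMeasure_natLaw hη
  have hint := integrable_id_natLaw hθ
  rw [natLaw_eq_tilted θ hη] at hint ⊢
  exact klDiv_tilted_left_self_ne_top (integrable_exp_sub_mul hθ hη) (hint.const_mul _)

theorem toReal_klDiv_natLaw (hθ : θ ∈ E.Θ) (hη : η ∈ E.Θ) :
    (InformationTheory.klDiv (E.natLaw θ) (E.natLaw η)).toReal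
      = (θ - η) * E.mean θ - (E.logPartition θ - E.logPartition η) := by
  have := isProbabilityMeasure_natLaw hη
  have hint := integrable_id_natLaw hθ
  rw [← log_integral_exp_sub_mul hθ hη, mean, ← integral_const_mul]
  rw [natLaw_eq_tilted θ hη] at hint ⊢
  exact toReal_klDiv_tilted_left_self (integrable_exp_sub_mul hθ hη) (hint.const_mul _)

theorem injOn_natLaw : Set.InjOn E.natLaw E.Θ := by
  intro θ hθ η hη h
  by_contra hne
  have := isProbabilityMeasure_natLaw hη
  have hllr := llr_tilted_left_self_ae_eq (integrable_exp_sub_mul hθ hη)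
  rw [← natLaw_eq_tilted θ hη, h] at hllr
  set c := Real.log (∫ x, Real.exp ((θ - η) * x) ∂(E.natLaw η))
  have hzero : (0 : ℝ → ℝ) =ᵐ[E.ρ] fun x => (θ - η) * x - c :=
    (absolutelyContinuous_tilted (E.integrable_exp _ hη)).ae_le
      ((llr_self (E.natLaw η)).symm.trans hllr)
  refine E.nondegenerate (c / (θ - η)) ?_
  change ∀ᵐ x ∂E.ρ, x ∈ ({c / (θ - η)} : Set ℝ)
  filter_upwards [hzero] with x hx
  rw [Set.mem_singleton_iff, eq_div_iff (sub_ne_zero.2 hne), mul_comm]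
  exact (sub_eq_zero.1 hx.symm)

theorem toReal_klDiv_natLaw_pos (hθ : θ ∈ E.Θ) (hη : η ∈ E.Θ) (hne : θ ≠ η) :
    0 < (InformationTheory.klDiv (E.natLaw θ) (E.natLaw η)).toReal := by
  have := isProbabilityMeasure_natLaw hθ
  have := isProbabilityMeasure_natLaw hη
  exact ENNReal.toReal_pos
    (fun h => hne (injOn_natLaw hθ hη (InformationTheory.klDiv_eq_zero_iff.1 h)))
    (klDiv_natLaw_ne_top hθ hη)

-- The symmetrized divergence of two laws is `(η - θ) * (E.mean η - E.mean θ)`.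
theorem strictMonoOn_mean : StrictMonoOn E.mean E.Θ := by
  intro θ hθ η hη hlt
  have hθη := toReal_klDiv_natLaw_pos hθ hη hlt.ne
  have hηθ := toReal_klDiv_natLaw_pos hη hθ hlt.ne'
  rw [toReal_klDiv_natLaw hθ hη] at hθη
  rw [toReal_klDiv_natLaw hη hθ] at hηθ
  have : 0 < (η - θ) * (E.mean η - E.mean θ) := by linarith
  exact sub_pos.1 (pos_of_mul_pos_right this (sub_pos.2 hlt).le)

theorem natParam_mem (ha : a ∈ E.means) : E.natParam a ∈ E.Θ := Function.invFunOn_mem ha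

theorem mean_natParam (ha : a ∈ E.means) : E.mean (E.natParam a) = a := Function.invFunOn_eq ha

theorem natParam_mean (hθ : θ ∈ E.Θ) : E.natParam (E.mean θ) = θ :=
  strictMonoOn_mean.injOn (natParam_mem ⟨θ, hθ, rfl⟩) hθ (mean_natParam ⟨θ, hθ, rfl⟩)

theorem strictMonoOn_natParam : StrictMonoOn E.natParam E.means := by
  intro a ha b hb hab
  rwa [← strictMonoOn_mean.lt_iff_lt (natParam_mem ha) (natParam_mem hb), mean_natParam ha,
    mean_natParam hb]

theorem ordConnected_means : E.means.OrdConnected :=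
  (E.ordConnected_Θ.isPreconnected.image _ continuousOn_mean).ordConnected

theorem isOpen_means : IsOpen E.means := by
  rw [isOpen_iff_mem_nhds]
  rintro _ ⟨θ, hθ, rfl⟩
  have hmem := E.isOpen_Θ.eventually_mem hθ
  obtain ⟨s, hs, hsθ⟩ := ((hmem.filter_mono nhdsWithin_le_nhds).and
    (self_mem_nhdsWithin (s := Set.Iio θ))).exists
  obtain ⟨t, ht, hθt⟩ := ((hmem.filter_mono nhdsWithin_le_nhds).and
    (self_mem_nhdsWithin (s := Set.Ioi θ))).exists
  exact Filter.mem_of_superset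
    (Icc_mem_nhds (strictMonoOn_mean hs hθ hsθ) (strictMonoOn_mean hθ ht hθt))
    (ordConnected_means.out ⟨s, hs, rfl⟩ ⟨t, ht, rfl⟩)

theorem continuousOn_natParam : ContinuousOn E.natParam E.means := by
  intro a ha
  refine (strictMonoOn_natParam.continuousAt_of_image_mem_nhds
    (isOpen_means.mem_nhds ha) ?_).continuousWithinAt
  exact Filter.mem_of_superset (E.isOpen_Θ.mem_nhds (natParam_mem ha))
    fun θ hθ => ⟨E.mean θ, ⟨θ, hθ, rfl⟩, natParam_mean hθ⟩

theorem law_eq (ha : a ∈ E.means) : E.law a = E.natLaw (E.natParam a) := if_pos ha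

theorem integrable_id_law (ha : a ∈ E.means) : Integrable (fun x => x) (E.law a) := by
  rw [law_eq ha]
  exact integrable_id_natLaw (natParam_mem ha)

theorem integral_id_law (ha : a ∈ E.means) : ∫ x, x ∂(E.law a) = a := by
  rw [law_eq ha]
  exact mean_natParam ha

theorem d_eq (ha : a ∈ E.means) (hb : b ∈ E.means) :
    E.d a b = (E.natParam a - E.natParam b) * a
      - (E.logPartition (E.natParam a) - E.logPartition (E.natParam b)) := by
  rw [d, law_eq ha, law_eq hb, toReal_klDiv_natLaw (natParam_mem ha) (natParam_mem hb),
    mean_natParam ha]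

theorem d_nonneg (a b : ℝ) : 0 ≤ E.d a b := ENNReal.toReal_nonneg

theorem d_self (a : ℝ) : E.d a a = 0 := by simp [d]

theorem d_pos (ha : a ∈ E.means) (hb : b ∈ E.means) (hab : a ≠ b) : 0 < E.d a b := by
  rw [d, law_eq ha, law_eq hb]
  exact toReal_klDiv_natLaw_pos (natParam_mem ha) (natParam_mem hb)
    (strictMonoOn_natParam.injOn.ne ha hb hab)

theorem continuousOn_d_right (ha : a ∈ E.means) : ContinuousOn (E.d a) E.means := by
  have hlog : ContinuousOn (fun b => E.logPartition (E.natParam b)) E.means :=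
    continuousOn_logPartition.comp continuousOn_natParam fun b hb => natParam_mem hb
  exact ContinuousOn.congr
    (((continuousOn_const.sub continuousOn_natParam).mul continuousOn_const).sub
      (continuousOn_const.sub hlog)) fun b hb => d_eq ha hb

theorem d_three_point (ha : a ∈ E.means) (hb : b ∈ E.means) (hc : c ∈ E.means) :
    E.d a c = E.d a b + E.d b c + (E.natParam c - E.natParam b) * (b - a) := by
  rw [d_eq ha hc, d_eq ha hb, d_eq hb hc]
  ring

theorem strictMonoOn_d_right (ha : a ∈ E.means) :
    StrictMonoOn (E.d a) (E.means ∩ Set.Ici a) := by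
  rintro b ⟨hb, hab⟩ c ⟨hc, -⟩ hbc
  have hnat := mul_nonneg (sub_pos.2 (strictMonoOn_natParam hb hc hbc)).le (sub_nonneg.2 hab)
  linarith [d_three_point ha hb hc, d_pos hb hc hbc.ne]

theorem strictAntiOn_d_right (ha : a ∈ E.means) :
    StrictAntiOn (E.d a) (E.means ∩ Set.Iic a) := by
  rintro c ⟨hc, -⟩ b ⟨hb, hba⟩ hcb
  have hnat := mul_nonneg (sub_pos.2 (strictMonoOn_natParam hc hb hcb)).le (sub_nonneg.2 hba)
  linarith [d_three_point ha hb hc, d_pos hb hc hcb.ne']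

theorem d_compensation (ha : a ∈ E.means) (hb : b ∈ E.means) (hm : m ∈ E.means)
    (hc : c ∈ E.means) (h : (u + v) * m = u * a + v * b) :
    u * E.d a c + v * E.d b c = u * E.d a m + v * E.d b m + (u + v) * E.d m c := by
  rw [d_eq ha hc, d_eq hb hc, d_eq ha hm, d_eq hb hm, d_eq hm hc]
  linear_combination (E.natParam c - E.natParam m) * h

/-- The logarithm of the density of the law with mean `a` with respect to the law with mean `b`. -/
noncomputable def logLikelihoodRatio (E : ExpFamily) (a b x : ℝ) : ℝ :=
  (E.natParam a - E.natParam b) * x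
    - (E.logPartition (E.natParam a) - E.logPartition (E.natParam b))

@[fun_prop]
theorem measurable_logLikelihoodRatio (a b : ℝ) : Measurable (E.logLikelihoodRatio a b) := by
  unfold logLikelihoodRatio
  fun_prop

theorem integrable_logLikelihoodRatio (ha : a ∈ E.means) (b : ℝ) :
    Integrable (E.logLikelihoodRatio a b) (E.law a) :=
  ((integrable_id_law ha).const_mul _).sub (integrable_const _)

theorem integral_logLikelihoodRatio (ha : a ∈ E.means) (hb : b ∈ E.means) :
    ∫ x, E.logLikelihoodRatio a b x ∂(E.law a) = E.d a b := by
  simp only [logLikelihoodRatio]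
  rw [integral_sub ((integrable_id_law ha).const_mul _) (integrable_const _), integral_const_mul,
    integral_id_law ha, integral_const, probReal_univ, one_smul, d_eq ha hb]

theorem law_eq_withDensity (ha : a ∈ E.means) (hb : b ∈ E.means) :
    E.law b = (E.law a).withDensity
      fun x => ENNReal.ofReal (Real.exp (-E.logLikelihoodRatio a b x)) := by
  have hθ := natParam_mem ha
  have hη := natParam_mem hb
  have := isProbabilityMeasure_natLaw hθ
  rw [law_eq ha, law_eq hb, natLaw_eq_tilted (E.natParam b) hθ, Measure.tilted]
  congr 1 with x
  rw [← Real.exp_log (integral_exp_pos (integrable_exp_sub_mul hη hθ)),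
    log_integral_exp_sub_mul hη hθ, ← Real.exp_sub, logLikelihoodRatio]
  congr 2
  ring

end ExpFamily

section Deviation

open ExpFamily Filter Topology

variable {E : ExpFamily} {K : ℕ} {μ : Fin K → ℝ} {j k : Fin K} {S : Finset (Fin K)} {c x y : ℝ}

theorem one_add_mul_mixedMean (μ : Fin K → ℝ) (j k : Fin K) (hx : 0 ≤ x) :
    (1 + x) * mixedMean μ j k x = μ k + x * μ j := by
  unfold mixedMean
  field_simp

theorem mixedMean_zero (μ : Fin K → ℝ) (j k : Fin K) : mixedMean μ j k 0 = μ k := by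
  simp [mixedMean]

theorem mixedMean_ne (hjk : μ k ≠ μ j) (hx : 0 ≤ x) : mixedMean μ j k x ≠ μ j := fun h =>
  hjk (by linarith [h ▸ one_add_mul_mixedMean μ j k hx])

theorem mixedMean_mem_means (hk : μ k ∈ E.means) (hj : μ j ∈ E.means) (hx : 0 ≤ x) :
    mixedMean μ j k x ∈ E.means := by
  convert convex_iff_div.1 ordConnected_means.convex hk hj zero_le_one hx (by linarith) using 1
  rw [mixedMean, smul_eq_mul, smul_eq_mul]
  ring

theorem le_mixedMean (hjk : μ k ≤ μ j) (hx : 0 ≤ x) : μ k ≤ mixedMean μ j k x := by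
  rw [mixedMean, le_div_iff₀ (by linarith)]
  linarith [mul_le_mul_of_nonneg_left hjk hx]

theorem mixedMean_le (hjk : μ k ≤ μ j) (hx : 0 ≤ x) : mixedMean μ j k x ≤ μ j := by
  rw [mixedMean, div_le_iff₀ (by linarith)]
  linarith

theorem strictMonoOn_mixedMean (hjk : μ k < μ j) : StrictMonoOn (mixedMean μ j k) (Set.Ici 0) := by
  intro x hx y hy hxy
  rw [Set.mem_Ici] at hx hy
  rw [mixedMean, mixedMean, div_lt_div_iff₀ (by linarith) (by linarith)]
  linarith [mul_pos (sub_pos.2 hjk) (sub_pos.2 hxy)]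

theorem continuousOn_mixedMean (μ : Fin K → ℝ) (j k : Fin K) :
    ContinuousOn (mixedMean μ j k) (Set.Ici 0) :=
  ContinuousOn.div (by fun_prop) (by fun_prop) fun x hx => by linarith [Set.mem_Ici.1 hx]

theorem tendsto_mixedMean (μ : Fin K → ℝ) (j k : Fin K) :
    Tendsto (mixedMean μ j k) atTop (𝓝 (μ j)) := by
  have hlim : Tendsto (fun x : ℝ => μ j + (μ k - μ j) / (1 + x)) atTop (𝓝 (μ j + 0)) :=
    tendsto_const_nhds.add
      (tendsto_const_nhds.div_atTop (tendsto_atTop_add_const_left _ _ tendsto_id))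
  rw [add_zero] at hlim
  refine hlim.congr' ?_
  filter_upwards [eventually_ge_atTop 0] with x hx
  unfold mixedMean
  field_simp
  ring

theorem continuousOn_d_mixedMean {i : Fin K} (hi : μ i ∈ E.means) (hk : μ k ∈ E.means)
    (hj : μ j ∈ E.means) : ContinuousOn (fun x => E.d (μ i) (mixedMean μ j k x)) (Set.Ici 0) :=
  (continuousOn_d_right hi).comp (continuousOn_mixedMean μ j k)
    fun _ hx => mixedMean_mem_means hk hj hx

theorem tendsto_d_mixedMean {i : Fin K} (hi : μ i ∈ E.means) (hj : μ j ∈ E.means) (k : Fin K) :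
    Tendsto (fun x => E.d (μ i) (mixedMean μ j k x)) atTop (𝓝 (E.d (μ i) (μ j))) :=
  ((continuousOn_d_right hi).continuousAt (isOpen_means.mem_nhds hj)).tendsto.comp
    (tendsto_mixedMean μ j k)

theorem d_mixedMean_pos (hk : μ k ∈ E.means) (hj : μ j ∈ E.means) (hjk : μ k ≠ μ j)
    (hx : 0 ≤ x) : 0 < E.d (μ j) (mixedMean μ j k x) :=
  d_pos hj (mixedMean_mem_means hk hj hx) (mixedMean_ne hjk hx).symm

theorem deviation_zero (E : ExpFamily) (μ : Fin K → ℝ) (j k : Fin K) : deviation E μ j k 0 = 0 := by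
  simp [deviation, mixedMean_zero, d_self]

theorem deviation_add (hk : μ k ∈ E.means) (hj : μ j ∈ E.means) (hc : c ∈ E.means)
    (hx : 0 ≤ x) :
    deviation E μ j k x + (1 + x) * E.d (mixedMean μ j k x) c
      = E.d (μ k) c + x * E.d (μ j) c := by
  have h := d_compensation (u := 1) (v := x) hk hj (mixedMean_mem_means hk hj hx) hc
    (by rw [one_add_mul_mixedMean μ j k hx, one_mul])
  rw [deviation]
  linarith

theorem deviation_le (hk : μ k ∈ E.means) (hj : μ j ∈ E.means) (hc : c ∈ E.means)
    (hx : 0 ≤ x) : deviation E μ j k x ≤ E.d (μ k) c + x * E.d (μ j) c := by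
  rw [← deviation_add hk hj hc hx]
  exact le_add_of_nonneg_right (mul_nonneg (by linarith) (d_nonneg _ _))

theorem deviation_le_of_le (hk : μ k ∈ E.means) (hj : μ j ∈ E.means) (hjk : μ k ≤ μ j) {a b : ℝ}
    (ha : a ∈ E.means) (hb : b ∈ E.means) (hba : b ≤ a) (hx : 0 ≤ x) :
    deviation E μ j k x ≤ E.d (μ k) a + x * E.d (μ j) b := by
  rcases le_total a (μ j) with haj | hja
  · refine (deviation_le hk hj ha hx).trans ?_
    gcongr
    exact (strictAntiOn_d_right hj).antitoneOn ⟨hb, hba.trans haj⟩ ⟨ha, haj⟩ hba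
  · calc deviation E μ j k x ≤ E.d (μ k) (μ j) + x * E.d (μ j) (μ j) := deviation_le hk hj hj hx
      _ ≤ E.d (μ k) a + x * E.d (μ j) b := by
        gcongr
        · exact (strictMonoOn_d_right hk).monotoneOn ⟨hj, hjk⟩ ⟨ha, hjk.trans hja⟩ hja
        · rw [d_self]
          exact d_nonneg _ _

theorem strictMonoOn_deviation (hk : μ k ∈ E.means) (hj : μ j ∈ E.means) (hjk : μ k ≠ μ j) :
    StrictMonoOn (deviation E μ j k) (Set.Ici 0) := by
  intro x hx y hy hxy
  refine (deviation_le hk hj (mixedMean_mem_means hk hj hy) hx).trans_lt ?_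
  rw [deviation]
  have := d_mixedMean_pos hk hj hjk hy
  gcongr

theorem continuousOn_deviation (hk : μ k ∈ E.means) (hj : μ j ∈ E.means) :
    ContinuousOn (deviation E μ j k) (Set.Ici 0) :=
  (continuousOn_d_mixedMean hk hk hj).add (continuousOn_id.mul (continuousOn_d_mixedMean hj hk hj))

theorem deviation_lt (hk : μ k ∈ E.means) (hj : μ j ∈ E.means) (hjk : μ k ≠ μ j) (hx : 0 ≤ x) :
    deviation E μ j k x < E.d (μ k) (μ j) := by
  have hx' : 0 ≤ x + 1 := by linarith
  calc deviation E μ j k x < deviation E μ j k (x + 1) :=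
        strictMonoOn_deviation hk hj hjk hx hx' (lt_add_one x)
    _ ≤ E.d (μ k) (μ j) + (x + 1) * E.d (μ j) (μ j) := deviation_le hk hj hj hx'
    _ = E.d (μ k) (μ j) := by rw [d_self, mul_zero, add_zero]

theorem image_deviation (hk : μ k ∈ E.means) (hj : μ j ∈ E.means) (hjk : μ k ≠ μ j) :
    deviation E μ j k '' Set.Ici 0 = Set.Ico 0 (E.d (μ k) (μ j)) := by
  apply Set.Subset.antisymm
  · rintro _ ⟨x, hx, rfl⟩
    refine ⟨?_, deviation_lt hk hj hjk hx⟩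
    rw [← deviation_zero E μ j k]
    exact (strictMonoOn_deviation hk hj hjk).monotoneOn Set.self_mem_Ici hx hx
  · rintro y ⟨hy0, hy⟩
    obtain ⟨x, hxy, hx⟩ := (((tendsto_d_mixedMean hk hj k).eventually (lt_mem_nhds hy)).and
      (eventually_ge_atTop 0)).exists
    have hle : y ≤ deviation E μ j k x :=
      hxy.le.trans (le_add_of_nonneg_right (mul_nonneg hx (d_nonneg _ _)))
    exact isPreconnected_Ici.intermediate_value Set.self_mem_Ici hx (continuousOn_deviation hk hj)
      ⟨(deviation_zero E μ j k).trans_le hy0, hle⟩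

theorem deviationInv_self (E : ExpFamily) (μ : Fin K → ℝ) (k : Fin K) (y : ℝ) :
    deviationInv E μ k k y = 1 := if_pos rfl

theorem invOn_deviationInv (hk : μ k ∈ E.means) (hj : μ j ∈ E.means) (hjk : μ k ≠ μ j) :
    Set.InvOn (deviationInv E μ j k) (deviation E μ j k) (Set.Ici 0)
      (Set.Ico 0 (E.d (μ k) (μ j))) := by
  have hinv : deviationInv E μ j k = Function.invFunOn (deviation E μ j k) (Set.Ici 0) :=
    funext fun _ => if_neg (ne_of_apply_ne μ hjk.symm)
  rw [hinv, ← image_deviation hk hj hjk]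
  exact (strictMonoOn_deviation hk hj hjk).injOn.bijOn_image.invOn_invFunOn

theorem deviationInv_nonneg (hk : μ k ∈ E.means) (hj : μ j ∈ E.means) (hjk : μ k ≠ μ j)
    (hy : y ∈ Set.Ico 0 (E.d (μ k) (μ j))) : 0 ≤ deviationInv E μ j k y := by
  rw [← image_deviation hk hj hjk] at hy
  obtain ⟨x, hx, rfl⟩ := hy
  exact ((invOn_deviationInv hk hj hjk).1 hx).symm ▸ hx

theorem deviationInv_zero (hk : μ k ∈ E.means) (hj : μ j ∈ E.means) (hjk : μ k ≠ μ j) :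
    deviationInv E μ j k 0 = 0 := by
  conv_lhs => rw [← deviation_zero E μ j k]
  exact (invOn_deviationInv hk hj hjk).1 Set.self_mem_Ici

theorem strictMonoOn_deviationInv (hk : μ k ∈ E.means) (hj : μ j ∈ E.means) (hjk : μ k ≠ μ j) :
    StrictMonoOn (deviationInv E μ j k) (Set.Ico 0 (E.d (μ k) (μ j))) := by
  intro y hy z hz hyz
  have hinv := (invOn_deviationInv hk hj hjk).2
  rwa [← (strictMonoOn_deviation hk hj hjk).lt_iff_lt (deviationInv_nonneg hk hj hjk hy)
    (deviationInv_nonneg hk hj hjk hz), hinv hy, hinv hz]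

theorem image_deviationInv (hk : μ k ∈ E.means) (hj : μ j ∈ E.means) (hjk : μ k ≠ μ j) :
    deviationInv E μ j k '' Set.Ico 0 (E.d (μ k) (μ j)) = Set.Ici 0 := by
  rw [← image_deviation hk hj hjk]
  exact (invOn_deviationInv hk hj hjk).1.image_image

theorem continuousOn_deviationInv (hk : μ k ∈ E.means) (hj : μ j ∈ E.means)
    (hjk : μ k ≠ μ j) :
    ContinuousOn (deviationInv E μ j k) (Set.Ico 0 (E.d (μ k) (μ j))) := by
  have hmono := strictMonoOn_deviationInv hk hj hjk
  intro y hy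
  rcases hy.1.eq_or_lt with rfl | hpos
  · refine ContinuousWithinAt.mono ?_ Set.Ico_subset_Ici_self
    refine hmono.continuousWithinAt_right_of_image_mem_nhdsWithin (Ico_mem_nhdsGE hy.2) ?_
    rw [image_deviationInv hk hj hjk, deviationInv_zero hk hj hjk]
    exact self_mem_nhdsWithin
  · refine (hmono.continuousAt_of_image_mem_nhds (Ico_mem_nhds hpos hy.2) ?_).continuousWithinAt
    rw [image_deviationInv hk hj hjk]
    refine Ici_mem_nhds ?_
    rw [← deviationInv_zero hk hj hjk]
    exact hmono ⟨le_rfl, hpos.trans hy.2⟩ hy hpos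

theorem strictMonoOn_d_mixedMean_div_d_mixedMean (hk : μ k ∈ E.means) (hj : μ j ∈ E.means)
    (hjk : μ k < μ j) :
    StrictMonoOn (fun x => E.d (μ k) (mixedMean μ j k x) / E.d (μ j) (mixedMean μ j k x))
      (Set.Ici 0) := by
  intro x hx y hy hxy
  have hlt := strictMonoOn_mixedMean hjk hx hy hxy
  have hxm := mixedMean_mem_means hk hj hx
  have hym := mixedMean_mem_means hk hj hy
  have hnum := strictMonoOn_d_right hk ⟨hxm, le_mixedMean hjk.le hx⟩ ⟨hym, le_mixedMean hjk.le hy⟩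
    hlt
  have hden := strictAntiOn_d_right hj ⟨hxm, mixedMean_le hjk.le hx⟩ ⟨hym, mixedMean_le hjk.le hy⟩
    hlt
  exact div_lt_div₀ hnum hden.le (d_nonneg _ _) (d_mixedMean_pos hk hj hjk.ne hy)

/-- The levels `y` at which all `x_{j,k}(y)`, `j ∈ S`, are defined (see `image_deviation`). -/
def levels (E : ExpFamily) {K : ℕ} (μ : Fin K → ℝ) (k : Fin K) (S : Finset (Fin K)) : Set ℝ :=
  ⋂ j ∈ S, Set.Ico 0 (E.d (μ k) (μ j))

theorem mem_levels : y ∈ levels E μ k S ↔ ∀ j ∈ S, y ∈ Set.Ico 0 (E.d (μ k) (μ j)) := by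
  simp only [levels, Set.mem_iInter]

theorem isEquilibrium_iff (hk : μ k ∈ E.means) (hS : ∀ j ∈ S, μ j ∈ E.means ∧ μ k ≠ μ j) :
    IsEquilibrium E μ k S y ↔ y ∈ levels E μ k S ∧ equilibrium E μ k S y = 1 := by
  rw [IsEquilibrium, mem_levels]
  refine and_congr_left' (forall₂_congr fun j hj => ?_)
  rw [image_deviation hk (hS j hj).1 (hS j hj).2]

theorem equilibrium_zero (hk : μ k ∈ E.means) (hS : ∀ j ∈ S, μ j ∈ E.means ∧ μ k ≠ μ j) :
    equilibrium E μ k S 0 = 0 :=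
  Finset.sum_eq_zero fun j hj => by
    rw [deviationInv_zero hk (hS j hj).1 (hS j hj).2, mixedMean_zero, d_self, zero_div]

theorem continuousOn_equilibrium (hk : μ k ∈ E.means)
    (hS : ∀ j ∈ S, μ j ∈ E.means ∧ μ k ≠ μ j) :
    ContinuousOn (equilibrium E μ k S) (levels E μ k S) := by
  refine continuousOn_finsetSum _ fun j hjS => ?_
  obtain ⟨hj, hjk⟩ := hS j hjS
  have hmaps : Set.MapsTo (deviationInv E μ j k) (levels E μ k S) (Set.Ici 0) := fun y hy =>
    deviationInv_nonneg hk hj hjk (mem_levels.1 hy j hjS)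
  have hcont : ContinuousOn (deviationInv E μ j k) (levels E μ k S) :=
    (continuousOn_deviationInv hk hj hjk).mono fun y hy => mem_levels.1 hy j hjS
  exact ((continuousOn_d_mixedMean hk hk hj).comp hcont hmaps).div
    ((continuousOn_d_mixedMean hj hk hj).comp hcont hmaps)
    fun y hy => (d_mixedMean_pos hk hj hjk (hmaps hy)).ne'

theorem strictMonoOn_equilibrium (hne : S.Nonempty) (hk : μ k ∈ E.means)
    (hS : ∀ j ∈ S, μ j ∈ E.means ∧ μ k < μ j) :
    StrictMonoOn (equilibrium E μ k S) (levels E μ k S) := by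
  intro y hy z hz hyz
  refine Finset.sum_lt_sum_of_nonempty hne fun j hjS => ?_
  obtain ⟨hj, hjk⟩ := hS j hjS
  rw [mem_levels] at hy hz
  exact strictMonoOn_d_mixedMean_div_d_mixedMean hk hj hjk
    (deviationInv_nonneg hk hj hjk.ne (hy j hjS)) (deviationInv_nonneg hk hj hjk.ne (hz j hjS))
    (strictMonoOn_deviationInv hk hj hjk.ne (hy j hjS) (hz j hjS) hyz)

theorem exists_one_le_equilibrium (hne : S.Nonempty) (hk : μ k ∈ E.means)
    (hS : ∀ j ∈ S, μ j ∈ E.means ∧ μ k ≠ μ j) :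
    ∃ y ∈ levels E μ k S, 1 ≤ equilibrium E μ k S y := by
  obtain ⟨i, hiS, hmin⟩ := S.exists_min_image (fun j => E.d (μ k) (μ j)) hne
  obtain ⟨hi, hik⟩ := hS i hiS
  obtain ⟨x, hlt, hx⟩ := (((tendsto_d_mixedMean hi hi k).eventually_lt
    (tendsto_d_mixedMean hk hi k) (by rw [d_self]; exact d_pos hk hi hik)).and
    (eventually_ge_atTop 0)).exists
  have hy : deviation E μ i k x ∈ Set.Ico 0 (E.d (μ k) (μ i)) :=
    image_deviation hk hi hik ▸ ⟨x, hx, rfl⟩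
  refine ⟨deviation E μ i k x,
    mem_levels.2 fun j hj => ⟨hy.1, hy.2.trans_le (hmin j hj)⟩, ?_⟩
  refine le_trans ?_ (Finset.single_le_sum (fun _ _ => div_nonneg (d_nonneg _ _) (d_nonneg _ _))
    hiS)
  rw [(invOn_deviationInv hk hi hik).1 hx, one_le_div (d_mixedMean_pos hk hi hik hx)]
  exact hlt.le

theorem existsUnique_isEquilibrium (hne : S.Nonempty) (hk : μ k ∈ E.means)
    (hS : ∀ j ∈ S, μ j ∈ E.means ∧ μ k < μ j) : ∃! y, IsEquilibrium E μ k S y := by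
  have hS' : ∀ j ∈ S, μ j ∈ E.means ∧ μ k ≠ μ j := fun j hj => (hS j hj).imp_right ne_of_lt
  simp only [isEquilibrium_iff hk hS']
  obtain ⟨z, hz, hz1⟩ := exists_one_le_equilibrium hne hk hS'
  have h0 : (0 : ℝ) ∈ levels E μ k S :=
    mem_levels.2 fun j hj => ⟨le_rfl, d_pos hk (hS' j hj).1 (hS' j hj).2⟩
  have hconn : IsPreconnected (levels E μ k S) :=
    (Set.ordConnected_biInter fun _ _ => Set.ordConnected_Ico).isPreconnected
  obtain ⟨y, hy, hy1⟩ := hconn.intermediate_value h0 hz (continuousOn_equilibrium hk hS')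
    ⟨(equilibrium_zero hk hS').trans_le zero_le_one, hz1⟩
  exact ⟨y, ⟨hy, hy1⟩, fun w ⟨hw, hw1⟩ =>
    (strictMonoOn_equilibrium hne hk hS).injOn hw hy (hw1.trans hy1.symm)⟩

theorem IsEquilibrium.pos (hne : S.Nonempty) (hk : μ k ∈ E.means)
    (hS : ∀ j ∈ S, μ j ∈ E.means ∧ μ k ≠ μ j) (hy : IsEquilibrium E μ k S y) : 0 < y := by
  obtain ⟨i, hi⟩ := hne
  rw [isEquilibrium_iff hk hS, mem_levels] at hy
  refine (hy.1 i hi).1.lt_of_ne ?_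
  rintro rfl
  exact zero_ne_one ((equilibrium_zero hk hS).symm.trans hy.2)

end Deviation

section Alternatives

open ExpFamily Filter Topology

variable {E : ExpFamily} {K : ℕ} {γ : ℝ} {μ l w : Fin K → ℝ} {i j k₀ : Fin K}

theorem mem_loadModels_of_lt (hl : ∀ k, l k ∈ E.means) (hi : ∀ j, j ≠ i → l i < l j)
    (hγ : l i ≠ γ) : l ∈ loadModels E K γ := by
  have hmin : ∀ j, l i ≤ l j := fun j => by
    rcases eq_or_ne j i with rfl | hj
    exacts [le_rfl, (hi j hj).le]
  have hunique : ∀ k, (∀ j, l k ≤ l j) → k = i := fun k hk =>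
    not_imp_comm.1 (hi k) (hk i).not_gt
  exact ⟨hl, ⟨i, hmin, hunique⟩, fun k hk => hunique k hk ▸ hγ⟩

theorem lt_of_ne_of_mem_loadModels (hμ : μ ∈ loadModels E K γ) (hk₀ : ∀ j, μ k₀ ≤ μ j) {j : Fin K}
    (hj : j ≠ k₀) : μ k₀ < μ j :=
  (hk₀ j).lt_of_ne fun heq => hj (hμ.2.1.unique (fun i => heq ▸ hk₀ i) hk₀)

theorem correctAnswers_subset_singleton_some (hγ₀ : μ k₀ < γ) (hmin : ∀ j, j ≠ k₀ → μ k₀ < μ j) :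
    correctAnswers γ μ ⊆ {some k₀} := by
  rintro (_ | k) hk
  · exact absurd (hk k₀) hγ₀.not_ge
  · exact congrArg some (not_imp_comm.1 (hmin k) (hk.2 k₀).not_gt)

theorem correctAnswers_eq_singleton_none (h : ∀ k, γ ≤ μ k) :
    correctAnswers γ μ = {none} := by
  refine Set.eq_singleton_iff_unique_mem.2 ⟨h, ?_⟩
  rintro (_ | k) hk
  exacts [rfl, absurd (h k) hk.1.not_ge]

theorem update_mem_means (hl : ∀ k, l k ∈ E.means) {c : ℝ} (hc : c ∈ E.means) (i k : Fin K) :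
    Function.update l i c k ∈ E.means := by
  rcases eq_or_ne k i with rfl | hk
  · rwa [Function.update_self]
  · rw [Function.update_of_ne hk]
    exact hl k

theorem tendsto_update_nhds_self {α : Type*} {F : Filter α} (l : Fin K → ℝ) (i : Fin K)
    {f : α → ℝ} (hf : Tendsto f F (𝓝 (l i))) :
    Tendsto (fun s => Function.update l i (f s)) F (𝓝 l) := by
  simpa only [Function.update_eq_self] using (tendsto_const_nhds (x := l)).update i hf

-- Lowering the minimal coordinate makes the minimizer unique and its load different from `γ`.
theorem mem_closure_loadModels [Nonempty (Fin K)] (hl : ∀ k, l k ∈ E.means) :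
    l ∈ closure (loadModels E K γ) := by
  obtain ⟨i, hi⟩ := Finite.exists_min l
  have hlim : Tendsto (fun s : ℝ => l i - s) (𝓝[>] 0) (𝓝 (l i)) :=
    ((continuous_const.sub continuous_id).tendsto' 0 (l i) (sub_zero _)).mono_left
      nhdsWithin_le_nhds
  have hne : ∀ᶠ s : ℝ in 𝓝[>] 0, s ≠ l i - γ :=
    (nhdsGT_le_nhdsNE 0).trans (nhdsNE_le_cofinite 0) (eventually_cofinite_ne _)
  refine mem_closure_of_tendsto (tendsto_update_nhds_self l i hlim) ?_
  filter_upwards [hlim.eventually (isOpen_means.eventually_mem (hl i)), hne, self_mem_nhdsWithin]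
    with s hs hsγ hs0
  refine mem_loadModels_of_lt (i := i) (update_mem_means hl hs i) (fun j hj => ?_) ?_
  · rw [Function.update_self, Function.update_of_ne hj]
    exact (sub_lt_self _ hs0).trans_le (hi j)
  · rw [Function.update_self]
    contrapose! hsγ
    linarith

theorem mem_closure_alternatives_of_lt (hl : ∀ k, l k ∈ E.means)
    (h : γ < l k₀ ∨ ∃ j, l j < l k₀) : l ∈ closure (alternatives E K γ (some k₀)) := by
  have := Nonempty.intro k₀
  have hopen : IsOpen {l : Fin K → ℝ | γ < l k₀ ∨ ∃ j, l j < l k₀} := by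
    simp only [Set.ofPred_or, Set.ofPred_exists]
    exact (isOpen_lt continuous_const (continuous_apply k₀)).union
      (isOpen_iUnion fun j => isOpen_lt (continuous_apply j) (continuous_apply k₀))
  refine closure_mono ?_ (hopen.inter_closure ⟨h, mem_closure_loadModels (γ := γ) hl⟩)
  rintro l' ⟨hlt | ⟨j, hj⟩, hl'⟩
  · exact ⟨hl', fun hmem => hlt.not_gt hmem.1⟩
  · exact ⟨hl', fun hmem => hj.not_ge (hmem.2 j)⟩

theorem mem_closure_alternatives (hl : ∀ k, l k ∈ E.means)
    (h : γ ≤ l k₀ ∨ ∃ j, j ≠ k₀ ∧ l j ≤ l k₀) : l ∈ closure (alternatives E K γ (some k₀)) := by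
  have hlim : Tendsto (fun s : ℝ => l k₀ + s) (𝓝[>] 0) (𝓝 (l k₀)) :=
    ((continuous_const.add continuous_id).tendsto' 0 (l k₀) (add_zero _)).mono_left
      nhdsWithin_le_nhds
  refine isClosed_closure.mem_of_tendsto (tendsto_update_nhds_self l k₀ hlim) ?_
  filter_upwards [hlim.eventually (isOpen_means.eventually_mem (hl k₀)), self_mem_nhdsWithin]
    with s hs hs0
  refine mem_closure_alternatives_of_lt (update_mem_means hl hs k₀) ?_
  rw [Function.update_self]
  refine h.imp (fun hγ => hγ.trans_lt (lt_add_of_pos_right _ hs0)) fun ⟨j, hj, hle⟩ => ⟨j, ?_⟩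
  rw [Function.update_of_ne hj]
  exact hle.trans_lt (lt_add_of_pos_right _ hs0)

theorem alternatives_nonempty (hμ : ∀ k, μ k ∈ E.means) (hγ : γ ∈ E.means) (k₀ : Fin K) :
    (alternatives E K γ (some k₀)).Nonempty :=
  closure_nonempty_iff.1 ⟨_, mem_closure_alternatives (update_mem_means hμ hγ k₀)
    (Or.inl (Function.update_self k₀ γ μ).ge)⟩

theorem informationRate_le_of_mem_closure {a : Option (Fin K)} (hμ : ∀ k, μ k ∈ E.means)
    (hw : ∀ k, 0 ≤ w k) (hl : ∀ k, l k ∈ E.means) (hmem : l ∈ closure (alternatives E K γ a)) :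
    informationRate E γ μ a w ≤ ∑ k, w k * E.d (μ k) (l k) := by
  have hbdd : BddBelow (Set.range fun l : alternatives E K γ a => ∑ k, w k * E.d (μ k) (l.1 k)) :=
    ⟨0, Set.forall_mem_range.2 fun l =>
      Finset.sum_nonneg fun k _ => mul_nonneg (hw k) (d_nonneg _ _)⟩
  have hcont : ContinuousAt (fun l : Fin K → ℝ => ∑ k, w k * E.d (μ k) (l k)) l :=
    tendsto_finsetSum _ fun k _ => (((continuousOn_d_right (hμ k)).continuousAt
      (isOpen_means.mem_nhds (hl k))).tendsto.comp (continuousAt_apply k l)).const_mul _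
  exact continuousWithinAt_const.closure_le hmem hcont.continuousWithinAt
    fun l' hl' => ciInf_le hbdd ⟨l', hl'⟩

theorem informationRate_le_threshold (hμ : ∀ k, μ k ∈ E.means) (hγ : γ ∈ E.means)
    (hw : ∀ k, 0 ≤ w k) (k₀ : Fin K) :
    informationRate E γ μ (some k₀) w ≤ w k₀ * E.d (μ k₀) γ := by
  have hl := update_mem_means hμ hγ k₀
  have h := informationRate_le_of_mem_closure hμ hw hl
    (mem_closure_alternatives hl (Or.inl (Function.update_self k₀ γ μ).ge))
  rwa [Finset.sum_eq_single_of_mem k₀ (Finset.mem_univ _) fun k _ hk => by simp [hk, d_self],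
    Function.update_self] at h

theorem informationRate_le_common (hμ : ∀ k, μ k ∈ E.means) (hw : ∀ k, 0 ≤ w k) (hj : j ≠ k₀)
    {c : ℝ} (hc : c ∈ E.means) :
    informationRate E γ μ (some k₀) w ≤ w k₀ * E.d (μ k₀) c + w j * E.d (μ j) c := by
  have hl := update_mem_means (update_mem_means hμ hc j) hc k₀
  have h := informationRate_le_of_mem_closure (γ := γ) hμ hw hl
    (mem_closure_alternatives hl (Or.inr ⟨j, hj, by simp [hj]⟩))
  rw [← Finset.sum_subset (Finset.subset_univ {k₀, j}) fun k _ hk => ?_,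
    Finset.sum_pair hj.symm] at h
  · simpa [hj] using h
  · simp only [Finset.mem_insert, Finset.mem_singleton, not_or] at hk
    simp [hk, d_self]

theorem informationRate_add_le (hμ : ∀ k, μ k ∈ E.means) (hw : ∀ k, 0 ≤ w k) (hj : j ≠ k₀)
    (hw₀ : 0 < w k₀) {c : ℝ} (hc : c ∈ E.means) :
    informationRate E γ μ (some k₀) w
        + (w k₀ + w j) * E.d (mixedMean μ j k₀ (w j / w k₀)) c
      ≤ w k₀ * E.d (μ k₀) c + w j * E.d (μ j) c := by
  have hx : 0 ≤ w j / w k₀ := div_nonneg (hw j) hw₀.le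
  have hm := mixedMean_mem_means (hμ k₀) (hμ j) hx
  have hmix : (w k₀ + w j) * mixedMean μ j k₀ (w j / w k₀) = w k₀ * μ k₀ + w j * μ j := by
    linear_combination (norm := (field_simp; ring)) w k₀ * one_add_mul_mixedMean μ j k₀ hx
  rw [d_compensation (hμ k₀) (hμ j) hm hc hmix]
  gcongr
  exact informationRate_le_common hμ hw hj hm

end Alternatives

section OptimalProportions

open ExpFamily

variable {E : ExpFamily} {K : ℕ} {γ r z : ℝ} {μ l w e : Fin K → ℝ} {j k k₀ : Fin K}

theorem mem_moreLoaded : j ∈ moreLoaded μ k ↔ μ k < μ j := by simp [moreLoaded]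

theorem moreLoaded_nonempty (hK : 2 ≤ K) (hmin : ∀ j, j ≠ k₀ → μ k₀ < μ j) :
    (moreLoaded μ k₀).Nonempty := by
  have := Fin.nontrivial_iff_two_le.2 hK
  exact (exists_ne k₀).imp fun j hj => mem_moreLoaded.2 (hmin j hj)

theorem moreLoaded_eq_erase (hmin : ∀ j, j ≠ k₀ → μ k₀ < μ j) :
    moreLoaded μ k₀ = Finset.univ.erase k₀ := by
  ext j
  simp only [mem_moreLoaded, Finset.mem_erase, Finset.mem_univ, and_true]
  exact ⟨fun h => ne_of_apply_ne μ h.ne', hmin j⟩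

theorem sum_eq_add_sum_moreLoaded (hmin : ∀ j, j ≠ k₀ → μ k₀ < μ j) (f : Fin K → ℝ) :
    ∑ k, f k = f k₀ + ∑ j ∈ moreLoaded μ k₀, f j := by
  rw [moreLoaded_eq_erase hmin, Finset.add_sum_erase _ _ (Finset.mem_univ _)]

/-- The common load of the slices `j` and `k` in the critical alternative at level `z`: the
minimizer of `c ↦ d(μ_k, c) + x_{j,k}(z) d(μ_j, c)`. -/
noncomputable def criticalMean (E : ExpFamily) {K : ℕ} (μ : Fin K → ℝ) (j k : Fin K) (z : ℝ) : ℝ :=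
  mixedMean μ j k (deviationInv E μ j k z)

/-- The Kuhn-Tucker conditions for the level `z` of the optimal measurement process: the threshold
alternatives and those with a better slice all have information at least `z`, and the multiplier
`1 - F_{k₀}(z)` of the threshold alternatives is nonnegative and vanishes unless they are
active. -/
structure IsOptimalLevel (E : ExpFamily) {K : ℕ} (γ : ℝ) (μ : Fin K → ℝ) (k₀ : Fin K) (z : ℝ) :
    Prop where
  pos : 0 < z
  mem_levels : z ∈ levels E μ k₀ (moreLoaded μ k₀)
  le_threshold : z ≤ E.d (μ k₀) γ
  equilibrium_le_one : equilibrium E μ k₀ (moreLoaded μ k₀) z ≤ 1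
  equilibrium_eq_one_or : equilibrium E μ k₀ (moreLoaded μ k₀) z = 1 ∨ z = E.d (μ k₀) γ

theorem IsEquilibrium.isOptimalLevel_min {y : ℝ} (hμ : ∀ k, μ k ∈ E.means) (hγ : γ ∈ E.means)
    (hγ₀ : μ k₀ ≠ γ) (hne : (moreLoaded μ k₀).Nonempty)
    (hy : IsEquilibrium E μ k₀ (moreLoaded μ k₀) y) :
    IsOptimalLevel E γ μ k₀ (min (E.d (μ k₀) γ) y) := by
  have hS : ∀ j ∈ moreLoaded μ k₀, μ j ∈ E.means ∧ μ k₀ < μ j := fun j hj =>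
    ⟨hμ j, mem_moreLoaded.1 hj⟩
  have hS' : ∀ j ∈ moreLoaded μ k₀, μ j ∈ E.means ∧ μ k₀ ≠ μ j := fun j hj =>
    (hS j hj).imp_right ne_of_lt
  obtain ⟨hyl, hy1⟩ := (isEquilibrium_iff (hμ k₀) hS').1 hy
  have hpos : 0 < min (E.d (μ k₀) γ) y :=
    lt_min (d_pos (hμ k₀) hγ hγ₀) (hy.pos hne (hμ k₀) hS')
  have hlevel : min (E.d (μ k₀) γ) y ∈ levels E μ k₀ (moreLoaded μ k₀) :=
    mem_levels.2 fun j hj => ⟨hpos.le, (min_le_right _ _).trans_lt (mem_levels.1 hyl j hj).2⟩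
  refine ⟨hpos, hlevel, min_le_left _ _, hy1 ▸ ?_, ?_⟩
  · exact (strictMonoOn_equilibrium hne (hμ k₀) hS).monotoneOn hlevel hyl (min_le_right _ _)
  · rcases min_choice (E.d (μ k₀) γ) y with h | h
    · exact Or.inr h
    · exact Or.inl (h.symm ▸ hy1)

namespace IsOptimalLevel

theorem mem_Ico (h : IsOptimalLevel E γ μ k₀ z) (hj : μ k₀ < μ j) :
    z ∈ Set.Ico 0 (E.d (μ k₀) (μ j)) :=
  _root_.mem_levels.1 h.mem_levels j (mem_moreLoaded.2 hj)

theorem deviationInv_nonneg (h : IsOptimalLevel E γ μ k₀ z) (hμ : ∀ k, μ k ∈ E.means)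
    (hmin : ∀ j, j ≠ k₀ → μ k₀ < μ j) (j : Fin K) : 0 ≤ deviationInv E μ j k₀ z := by
  rcases eq_or_ne j k₀ with rfl | hj
  · rw [deviationInv_self]
    exact zero_le_one
  · exact _root_.deviationInv_nonneg (hμ k₀) (hμ j) (hmin j hj).ne (h.mem_Ico (hmin j hj))

theorem criticalMean_mem_means (h : IsOptimalLevel E γ μ k₀ z) (hμ : ∀ k, μ k ∈ E.means)
    (hj : μ k₀ < μ j) : criticalMean E μ j k₀ z ∈ E.means :=
  mixedMean_mem_means (hμ k₀) (hμ j)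
    (_root_.deviationInv_nonneg (hμ k₀) (hμ j) hj.ne (h.mem_Ico hj))

theorem d_criticalMean_pos (h : IsOptimalLevel E γ μ k₀ z) (hμ : ∀ k, μ k ∈ E.means)
    (hj : μ k₀ < μ j) : 0 < E.d (μ j) (criticalMean E μ j k₀ z) :=
  d_mixedMean_pos (hμ k₀) (hμ j) hj.ne
    (_root_.deviationInv_nonneg (hμ k₀) (hμ j) hj.ne (h.mem_Ico hj))

theorem d_add_deviationInv_mul_d (h : IsOptimalLevel E γ μ k₀ z) (hμ : ∀ k, μ k ∈ E.means)
    (hj : μ k₀ < μ j) :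
    E.d (μ k₀) (criticalMean E μ j k₀ z)
      + deviationInv E μ j k₀ z * E.d (μ j) (criticalMean E μ j k₀ z) = z :=
  (invOn_deviationInv (hμ k₀) (hμ j) hj.ne).2 (h.mem_Ico hj)

theorem sum_deviationInv_pos (h : IsOptimalLevel E γ μ k₀ z) (hμ : ∀ k, μ k ∈ E.means)
    (hmin : ∀ j, j ≠ k₀ → μ k₀ < μ j) : 0 < ∑ k, deviationInv E μ k k₀ z := by
  refine Finset.sum_pos' (fun k _ => h.deviationInv_nonneg hμ hmin k) ⟨k₀, Finset.mem_univ _, ?_⟩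
  rw [deviationInv_self]
  exact zero_lt_one

theorem mul_characteristicTime (h : IsOptimalLevel E γ μ k₀ z) :
    z * characteristicTime E μ k₀ z = ∑ k, deviationInv E μ k k₀ z := by
  rw [characteristicTime, ← mul_assoc, mul_one_div_cancel h.pos.ne', one_mul]

theorem characteristicTime_pos (h : IsOptimalLevel E γ μ k₀ z) (hμ : ∀ k, μ k ∈ E.means)
    (hmin : ∀ j, j ≠ k₀ → μ k₀ < μ j) : 0 < characteristicTime E μ k₀ z :=
  mul_pos (one_div_pos.2 h.pos) (h.sum_deviationInv_pos hμ hmin)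

theorem proportions_mem_stdSimplex (h : IsOptimalLevel E γ μ k₀ z) (hμ : ∀ k, μ k ∈ E.means)
    (hmin : ∀ j, j ≠ k₀ → μ k₀ < μ j) : proportions E μ k₀ z ∈ stdSimplex ℝ (Fin K) := by
  have hsum := h.sum_deviationInv_pos hμ hmin
  have hw : proportions E μ k₀ z
      = fun k => deviationInv E μ k k₀ z / ∑ i, deviationInv E μ i k₀ z := by
    funext k
    rw [proportions, h.mul_characteristicTime]
  rw [hw]
  exact ⟨fun k => div_nonneg (h.deviationInv_nonneg hμ hmin k) hsum.le,
    by rw [← Finset.sum_div, div_self hsum.ne']⟩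

theorem characteristicTime_eq (h : IsOptimalLevel E γ μ k₀ z) (hμ : ∀ k, μ k ∈ E.means)
    (hmin : ∀ j, j ≠ k₀ → μ k₀ < μ j) :
    characteristicTime E μ k₀ z = (1 - equilibrium E μ k₀ (moreLoaded μ k₀) z) / z
      + ∑ j ∈ moreLoaded μ k₀, 1 / E.d (μ j) (criticalMean E μ j k₀ z) := by
  have hx : ∀ j ∈ moreLoaded μ k₀, deviationInv E μ j k₀ z
      = z * (1 / E.d (μ j) (criticalMean E μ j k₀ z))
        - E.d (μ k₀) (criticalMean E μ j k₀ z) / E.d (μ j) (criticalMean E μ j k₀ z) := by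
    intro j hj
    have hpos := h.d_criticalMean_pos hμ (mem_moreLoaded.1 hj)
    have hz := h.d_add_deviationInv_mul_d hμ (mem_moreLoaded.1 hj)
    field_simp
    linarith
  have hz := h.pos.ne'
  rw [← mul_right_inj' hz, h.mul_characteristicTime, sum_eq_add_sum_moreLoaded hmin,
    deviationInv_self, Finset.sum_congr rfl hx, Finset.sum_sub_distrib, ← Finset.mul_sum, mul_add,
    mul_div_cancel₀ _ hz, equilibrium]
  simp only [criticalMean]
  ring

theorem sum_eq (h : IsOptimalLevel E γ μ k₀ z) (hμ : ∀ k, μ k ∈ E.means)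
    (hmin : ∀ j, j ≠ k₀ → μ k₀ < μ j) (w : Fin K → ℝ) :
    ∑ k, w k = w k₀ * (1 - equilibrium E μ k₀ (moreLoaded μ k₀) z)
      + ∑ j ∈ moreLoaded μ k₀, (w k₀ * E.d (μ k₀) (criticalMean E μ j k₀ z)
          + w j * E.d (μ j) (criticalMean E μ j k₀ z)) / E.d (μ j) (criticalMean E μ j k₀ z) := by
  have hterm : ∀ j ∈ moreLoaded μ k₀, (w k₀ * E.d (μ k₀) (criticalMean E μ j k₀ z)
      + w j * E.d (μ j) (criticalMean E μ j k₀ z)) / E.d (μ j) (criticalMean E μ j k₀ z)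
      = w k₀ * (E.d (μ k₀) (criticalMean E μ j k₀ z) / E.d (μ j) (criticalMean E μ j k₀ z))
        + w j := fun j hj => by
    have hpos := h.d_criticalMean_pos hμ (mem_moreLoaded.1 hj)
    field_simp
  rw [Finset.sum_congr rfl hterm, Finset.sum_add_distrib, ← Finset.mul_sum,
    sum_eq_add_sum_moreLoaded hmin, equilibrium]
  simp only [criticalMean]
  ring

-- Weak duality: the constraints, weighted by `(1 - F) / z` and by `1 / d(μ_j, m_j)`, add up.
theorem mul_characteristicTime_add_le (h : IsOptimalLevel E γ μ k₀ z)
    (hμ : ∀ k, μ k ∈ E.means) (hmin : ∀ j, j ≠ k₀ → μ k₀ < μ j)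
    (hthreshold : r ≤ w k₀ * E.d (μ k₀) γ)
    (hcommon : ∀ j ∈ moreLoaded μ k₀, r + e j ≤ w k₀ * E.d (μ k₀) (criticalMean E μ j k₀ z)
      + w j * E.d (μ j) (criticalMean E μ j k₀ z)) :
    r * characteristicTime E μ k₀ z
        + ∑ j ∈ moreLoaded μ k₀, e j / E.d (μ j) (criticalMean E μ j k₀ z)
      ≤ ∑ k, w k := by
  have hslack : r * ((1 - equilibrium E μ k₀ (moreLoaded μ k₀) z) / z)
      ≤ w k₀ * (1 - equilibrium E μ k₀ (moreLoaded μ k₀) z) := by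
    rcases h.equilibrium_eq_one_or with h1 | hz
    · simp [h1]
    · rw [mul_div_left_comm, mul_comm (w k₀)]
      refine mul_le_mul_of_nonneg_left ?_ (sub_nonneg.2 h.equilibrium_le_one)
      rwa [div_le_iff₀ h.pos, hz]
  rw [h.characteristicTime_eq hμ hmin, h.sum_eq hμ hmin w, mul_add, add_assoc, Finset.mul_sum,
    ← Finset.sum_add_distrib]
  refine add_le_add hslack (Finset.sum_le_sum fun j hj => ?_)
  rw [mul_one_div, ← add_div]
  exact div_le_div_of_nonneg_right (hcommon j hj) (d_nonneg _ _)

theorem informationRate_mul_characteristicTime_le (h : IsOptimalLevel E γ μ k₀ z)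
    (hμ : ∀ k, μ k ∈ E.means) (hγ : γ ∈ E.means) (hmin : ∀ j, j ≠ k₀ → μ k₀ < μ j)
    (hw : ∀ k, 0 ≤ w k) :
    informationRate E γ μ (some k₀) w * characteristicTime E μ k₀ z ≤ ∑ k, w k := by
  have hle := h.mul_characteristicTime_add_le (e := 0) hμ hmin
    (informationRate_le_threshold hμ hγ hw k₀) fun j hj => by
      have hj := mem_moreLoaded.1 hj
      rw [Pi.zero_apply, add_zero]
      exact informationRate_le_common hμ hw (ne_of_apply_ne μ hj.ne')
        (h.criticalMean_mem_means hμ hj)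
  simpa using hle

theorem le_sum_deviationInv_mul_d (h : IsOptimalLevel E γ μ k₀ z) (hμ : ∀ k, μ k ∈ E.means)
    (hγ : γ ∈ E.means) (hmin : ∀ j, j ≠ k₀ → μ k₀ < μ j) (hγ₀ : μ k₀ ≤ γ)
    (hl : l ∈ alternatives E K γ (some k₀)) :
    z ≤ ∑ k, deviationInv E μ k k₀ z * E.d (μ k) (l k) := by
  have hnonneg : ∀ k, 0 ≤ deviationInv E μ k k₀ z * E.d (μ k) (l k) := fun k =>
    mul_nonneg (h.deviationInv_nonneg hμ hmin k) (d_nonneg _ _)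
  have hlm := hl.1.1
  by_cases hc : γ ≤ l k₀
  · calc z ≤ E.d (μ k₀) γ := h.le_threshold
      _ ≤ E.d (μ k₀) (l k₀) := (strictMonoOn_d_right (hμ k₀)).monotoneOn ⟨hγ, hγ₀⟩
        ⟨hlm k₀, hγ₀.trans hc⟩ hc
      _ = deviationInv E μ k₀ k₀ z * E.d (μ k₀) (l k₀) := by rw [deviationInv_self, one_mul]
      _ ≤ _ := Finset.single_le_sum (fun k _ => hnonneg k) (Finset.mem_univ k₀)
  · obtain ⟨j, hj⟩ : ∃ j, l j < l k₀ := by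
      by_contra! hle
      exact hl.2 ⟨not_le.1 hc, hle⟩
    have hjk : j ≠ k₀ := ne_of_apply_ne l hj.ne
    have hinv := (invOn_deviationInv (hμ k₀) (hμ j) (hmin j hjk).ne).2 (h.mem_Ico (hmin j hjk))
    calc z = deviation E μ j k₀ (deviationInv E μ j k₀ z) := hinv.symm
      _ ≤ E.d (μ k₀) (l k₀) + deviationInv E μ j k₀ z * E.d (μ j) (l j) :=
        deviation_le_of_le (hμ k₀) (hμ j) (hmin j hjk).le (hlm k₀) (hlm j) hj.le
          (h.deviationInv_nonneg hμ hmin j)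
      _ = ∑ k ∈ {k₀, j}, deviationInv E μ k k₀ z * E.d (μ k) (l k) := by
        rw [Finset.sum_pair hjk.symm, deviationInv_self, one_mul]
      _ ≤ _ := Finset.sum_le_sum_of_subset_of_nonneg (Finset.subset_univ _) fun k _ _ => hnonneg k

theorem informationRate_proportions (h : IsOptimalLevel E γ μ k₀ z) (hμ : ∀ k, μ k ∈ E.means)
    (hγ : γ ∈ E.means) (hmin : ∀ j, j ≠ k₀ → μ k₀ < μ j) (hγ₀ : μ k₀ ≤ γ) :
    informationRate E γ μ (some k₀) (proportions E μ k₀ z) = (characteristicTime E μ k₀ z)⁻¹ := by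
  have hT := h.characteristicTime_pos hμ hmin
  obtain ⟨hw, hw1⟩ := h.proportions_mem_stdSimplex hμ hmin
  apply le_antisymm
  · rw [← one_div, le_div_iff₀ hT, ← hw1]
    exact h.informationRate_mul_characteristicTime_le hμ hγ hmin hw
  · have := (alternatives_nonempty hμ hγ k₀).to_subtype
    refine le_ciInf fun l => ?_
    simp only [proportions, div_mul_eq_mul_div]
    rw [← Finset.sum_div, le_div_iff₀ (mul_pos h.pos hT), mul_comm z, inv_mul_cancel_left₀ hT.ne']
    exact h.le_sum_deviationInv_mul_d hμ hγ hmin hγ₀ l.2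

theorem eq_mul_deviationInv (h : IsOptimalLevel E γ μ k₀ z) (hμ : ∀ k, μ k ∈ E.means)
    (hγ : γ ∈ E.means) (hmin : ∀ j, j ≠ k₀ → μ k₀ < μ j) (hw : ∀ k, 0 ≤ w k) (hw₀ : 0 < w k₀)
    (hle : ∑ k, w k ≤ informationRate E γ μ (some k₀) w * characteristicTime E μ k₀ z)
    (j : Fin K) : w j = w k₀ * deviationInv E μ j k₀ z := by
  rcases eq_or_ne j k₀ with rfl | hj
  · rw [deviationInv_self, mul_one]
  have hjk := hmin j hj
  let e : Fin K → ℝ := fun i =>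
    (w k₀ + w i) * E.d (mixedMean μ i k₀ (w i / w k₀)) (criticalMean E μ i k₀ z)
  have he : ∀ i ∈ moreLoaded μ k₀, 0 ≤ e i / E.d (μ i) (criticalMean E μ i k₀ z) := fun i _ =>
    div_nonneg (mul_nonneg (add_nonneg hw₀.le (hw i)) (d_nonneg _ _)) (d_nonneg _ _)
  have hadd := h.mul_characteristicTime_add_le (e := e) hμ hmin
    (informationRate_le_threshold hμ hγ hw k₀) fun i hi =>
      informationRate_add_le hμ hw (ne_of_apply_ne μ (mem_moreLoaded.1 hi).ne') hw₀
        (h.criticalMean_mem_means hμ (mem_moreLoaded.1 hi))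
  have hej : e j / E.d (μ j) (criticalMean E μ j k₀ z) ≤ 0 :=
    (Finset.single_le_sum he (mem_moreLoaded.2 hjk)).trans (by linarith)
  have hx : 0 ≤ w j / w k₀ := div_nonneg (hw j) hw₀.le
  have hmix : mixedMean μ j k₀ (w j / w k₀) = criticalMean E μ j k₀ z := by
    by_contra hne
    have hd := d_pos (mixedMean_mem_means (hμ k₀) (hμ j) hx)
      (h.criticalMean_mem_means hμ hjk) hne
    exact hej.not_gt (div_pos (mul_pos (add_pos_of_pos_of_nonneg hw₀ (hw j)) hd)
      (h.d_criticalMean_pos hμ hjk))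
  rw [← (strictMonoOn_mixedMean hjk).injOn hx (h.deviationInv_nonneg hμ hmin j) hmix,
    mul_div_cancel₀ _ hw₀.ne']

theorem informationRate_lt (h : IsOptimalLevel E γ μ k₀ z) (hμ : ∀ k, μ k ∈ E.means)
    (hγ : γ ∈ E.means) (hmin : ∀ j, j ≠ k₀ → μ k₀ < μ j) (hw : w ∈ stdSimplex ℝ (Fin K))
    (hne : w ≠ proportions E μ k₀ z) :
    informationRate E γ μ (some k₀) w < (characteristicTime E μ k₀ z)⁻¹ := by
  have hT := h.characteristicTime_pos hμ hmin
  contrapose! hne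
  have hw₀ : 0 < w k₀ := (pos_iff_pos_of_mul_pos (((inv_pos.2 hT).trans_le hne).trans_le
    (informationRate_le_threshold hμ hγ hw.1 k₀))).2 (h.pos.trans_le h.le_threshold)
  have hwx := h.eq_mul_deviationInv hμ hγ hmin hw.1 hw₀ <| by
    rwa [hw.2, ← div_le_iff₀ hT, one_div]
  have hsum : w k₀ * ∑ k, deviationInv E μ k k₀ z = 1 := by
    rw [Finset.mul_sum, ← hw.2]
    exact Finset.sum_congr rfl fun k _ => (hwx k).symm
  ext k
  rw [proportions, h.mul_characteristicTime, hwx k,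
    eq_div_iff (h.sum_deviationInv_pos hμ hmin).ne', mul_right_comm, hsum, one_mul]

end IsOptimalLevel

end OptimalProportions

section ChangeOfMeasure

open ExpFamily

theorem setLIntegral_inter_preimage_of_indep {Ω α : Type*} {m mΩ : MeasurableSpace Ω}
    {mα : MeasurableSpace α} {P : Measure Ω} {X : Ω → α} {B : Set Ω} {D : Set α}
    {f : Ω → ENNReal} {g : α → ENNReal} (hm : m ≤ mΩ) (hX : Measurable X)
    (hind : Indep m (mα.comap X) P) (hf : Measurable[m] f) (hg : Measurable g)
    (hB : MeasurableSet[m] B) (hD : MeasurableSet D) :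
    ∫⁻ ω in B ∩ X ⁻¹' D, f ω * g (X ω) ∂P = (∫⁻ ω in B, f ω ∂P) * ∫⁻ x in D, g x ∂(P.map X) := by
  have hgD := hg.indicator hD
  calc ∫⁻ ω in B ∩ X ⁻¹' D, f ω * g (X ω) ∂P
      = ∫⁻ ω, B.indicator f ω * D.indicator g (X ω) ∂P := by
        rw [← lintegral_indicator ((hm _ hB).inter (hX hD))]
        exact lintegral_congr fun ω => Set.inter_indicator_mul f (g ∘ X) ω
    _ = (∫⁻ ω, B.indicator f ω ∂P) * ∫⁻ ω, D.indicator g (X ω) ∂P :=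
        lintegral_mul_eq_lintegral_mul_lintegral_of_independent_measurableSpace hm hX.comap_le hind
          (hf.indicator hB) (hgD.comp (comap_measurable X))
    _ = (∫⁻ ω in B, f ω ∂P) * ∫⁻ x in D, g x ∂(P.map X) := by
        rw [lintegral_indicator (hm _ hB), ← lintegral_map hgD hX, lintegral_indicator hD]

variable {E : ExpFamily} {K : ℕ} {slice : ℕ → Outcome K → Fin K} {l l' : Fin K → ℝ} {s t : ℕ}
  {B : Set (Outcome K)}

instance isProbabilityMeasure_outcomeMeasure (l : Fin K → ℝ) :
    IsProbabilityMeasure (outcomeMeasure E l) := by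
  unfold outcomeMeasure
  infer_instance

theorem measurePreserving_outcome (l : Fin K → ℝ) (t : ℕ) (k : Fin K) :
    MeasurePreserving (fun ω : Outcome K => ω t k) (outcomeMeasure E l) (E.law (l k)) :=
  (measurePreserving_eval (fun k => E.law (l k)) k).comp
    (measurePreserving_eval_infinitePi (fun _ : ℕ => Measure.pi fun k : Fin K => E.law (l k)) t)

theorem history_mono (slice : ℕ → Outcome K → Fin K) : Monotone (history slice) :=
  fun _ t hst => iSup_le fun i => le_iSup
    (fun j : Fin t => MeasurableSpace.comap (observation slice j) inferInstance) (Fin.castLE hst i)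

theorem measurable_observation (slice : ℕ → Outcome K → Fin K) (hst : s < t) :
    Measurable[history slice t] (observation slice s) :=
  Measurable.of_comap_le
    (le_iSup (fun j : Fin t => MeasurableSpace.comap (observation slice j) inferInstance) ⟨s, hst⟩)

theorem history_le_iSup_comap (h : ∀ t, Measurable[history slice t] (slice t)) (t : ℕ) :
    history slice t
      ≤ ⨆ s ∈ Set.Iio t, MeasurableSpace.comap (fun ω : Outcome K => ω s) inferInstance := by
  induction t using Nat.strong_induction_on with
  | _ t ih =>
    refine iSup_le fun s => ?_
    have hmono : (⨆ r ∈ Set.Iio (s : ℕ), MeasurableSpace.comap (fun ω : Outcome K => ω r)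
        inferInstance) ≤ ⨆ r ∈ Set.Iio t, MeasurableSpace.comap (fun ω => ω r) inferInstance :=
      biSup_mono fun r hr => lt_trans hr s.2
    have hslice := (h s).mono ((ih s s.2).trans hmono) le_rfl
    have hω : Measurable[⨆ r ∈ Set.Iio t, MeasurableSpace.comap (fun ω => ω r) inferInstance]
        fun ω : Outcome K => ω s :=
      Measurable.of_comap_le (le_biSup (fun r : ℕ =>
        MeasurableSpace.comap (fun ω : Outcome K => ω r) inferInstance) (Set.mem_Iio.2 s.2))
    have heval : Measurable fun p : Fin K × (Fin K → ℝ) => p.2 p.1 :=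
      measurable_from_prod_countable_right fun k => measurable_pi_apply k
    exact (hslice.prodMk (heval.comp (hslice.prodMk hω))).comap_le

theorem indep_history (h : ∀ t, Measurable[history slice t] (slice t)) (l : Fin K → ℝ) (t : ℕ)
    (k : Fin K) : Indep (history slice t)
      (MeasurableSpace.comap (fun ω : Outcome K => ω t k) inferInstance) (outcomeMeasure E l) := by
  have hindep : iIndepFun (fun (i : ℕ) (ω : Outcome K) => ω i) (outcomeMeasure E l) :=
    iIndepFun_infinitePi (P := fun _ : ℕ => Measure.pi fun k : Fin K => E.law (l k))
      (X := fun _ x => x) fun _ => measurable_id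
  have hdisj := indep_iSup_of_disjoint (fun i => (measurable_pi_apply i).comap_le) hindep
    (S := Set.Iio t) (T := {t}) (by simp)
  refine indep_of_indep_of_le_left (indep_of_indep_of_le_right hdisj ?_) (history_le_iSup_comap h t)
  rw [iSup_singleton]
  exact ((measurable_pi_apply k).comp (comap_measurable fun ω : Outcome K => ω t)).comap_le

theorem iUnion_inter_slice_eq (B : Set (Outcome K)) (t : ℕ) :
    ⋃ k, B ∩ {ω | slice t ω = k} = B := by
  ext ω
  simp

theorem pairwise_disjoint_inter_slice_eq (B : Set (Outcome K)) (t : ℕ) :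
    Pairwise (Function.onFun Disjoint fun k => B ∩ {ω | slice t ω = k}) := fun _ _ hij =>
  Set.disjoint_left.2 fun _ hi hj => hij (hi.2.symm.trans hj.2)

theorem measurableSet_inter_slice_eq (h : ∀ t, Measurable[history slice t] (slice t))
    (hB : MeasurableSet[history slice t] B) (k : Fin K) :
    MeasurableSet[history slice t] (B ∩ {ω | slice t ω = k}) :=
  MeasurableSet.inter hB (h t (measurableSet_singleton k))

theorem setLIntegral_mul_observation (h : ∀ t, Measurable[history slice t] (slice t))
    (l : Fin K → ℝ) {f : Outcome K → ENNReal} {g : Fin K × ℝ → ENNReal} {C : Set (Fin K × ℝ)}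
    (hf : Measurable[history slice t] f) (hg : Measurable g)
    (hB : MeasurableSet[history slice t] B) (hC : MeasurableSet C) :
    ∫⁻ ω in B ∩ observation slice t ⁻¹' C, f ω * g (observation slice t ω) ∂(outcomeMeasure E l)
      = ∑ k, (∫⁻ ω in B ∩ {ω | slice t ω = k}, f ω ∂(outcomeMeasure E l))
          * ∫⁻ x in Prod.mk k ⁻¹' C, g (k, x) ∂(E.law (l k)) := by
  have hle := history_le slice h t
  have hBk := measurableSet_inter_slice_eq h hB
  have hBC : MeasurableSet (B ∩ observation slice t ⁻¹' C) :=
    (hle _ hB).inter (((measurable_observation slice t.lt_succ_self).mono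
      (history_le slice h _) le_rfl) hC)
  have hswap : ∀ k, B ∩ observation slice t ⁻¹' C ∩ {ω | slice t ω = k}
      = B ∩ {ω | slice t ω = k} ∩ (fun ω => ω t k) ⁻¹' (Prod.mk k ⁻¹' C) := by
    rintro k
    ext ω
    constructor
    · rintro ⟨⟨hωB, hωC⟩, rfl⟩
      exact ⟨⟨hωB, rfl⟩, hωC⟩
    · rintro ⟨⟨hωB, rfl⟩, hωC⟩
      exact ⟨⟨hωB, hωC⟩, rfl⟩
  have hmeas : ∀ k, MeasurableSet (B ∩ observation slice t ⁻¹' C ∩ {ω | slice t ω = k}) := fun k =>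
    hBC.inter (hle _ (h t (measurableSet_singleton k)))
  rw [← iUnion_inter_slice_eq (B ∩ observation slice t ⁻¹' C) t,
    lintegral_iUnion hmeas (pairwise_disjoint_inter_slice_eq _ t), tsum_fintype]
  refine Finset.sum_congr rfl fun k _ => ?_
  have hmp := measurePreserving_outcome (E := E) l t k
  rw [← hmp.map_eq, ← setLIntegral_inter_preimage_of_indep (g := fun x => g (k, x)) hle
    hmp.measurable (indep_history h l t k) hf (hg.comp measurable_prodMk_left) (hBk k)
    (measurable_prodMk_left hC), ← hswap]
  exact setLIntegral_congr_fun (hmeas k) fun ω hω => by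
    obtain ⟨-, rfl⟩ := hω
    rfl

/-- Cylinders over the history up to time `t` and the next observation: a π-system generating the
history up to time `t + 1`. -/
def historyRectangles (slice : ℕ → Outcome K → Fin K) (t : ℕ) : Set (Set (Outcome K)) :=
  {A | ∃ B C, MeasurableSet[history slice t] B ∧ MeasurableSet C ∧
    A = B ∩ observation slice t ⁻¹' C}

theorem isPiSystem_historyRectangles (slice : ℕ → Outcome K → Fin K) (t : ℕ) :
    IsPiSystem (historyRectangles slice t) := by
  rintro _ ⟨B, C, hB, hC, rfl⟩ _ ⟨B', C', hB', hC', rfl⟩ _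
  exact ⟨B ∩ B', C ∩ C', MeasurableSet.inter hB hB', hC.inter hC', by
    rw [Set.preimage_inter, Set.inter_inter_inter_comm]⟩

theorem history_succ_eq_generateFrom (slice : ℕ → Outcome K → Fin K) (t : ℕ) :
    history slice (t + 1) = MeasurableSpace.generateFrom (historyRectangles slice t) := by
  apply le_antisymm
  · refine iSup_le fun s => ?_
    rintro _ ⟨C, hC, rfl⟩
    apply MeasurableSpace.measurableSet_generateFrom
    rcases (Nat.lt_succ_iff.1 s.2).eq_or_lt with hs | hs
    · exact ⟨Set.univ, C, MeasurableSet.univ, hC, by rw [Set.univ_inter, hs]⟩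
    · exact ⟨observation slice s ⁻¹' C, Set.univ, measurable_observation slice hs hC,
        MeasurableSet.univ, by rw [Set.preimage_univ, Set.inter_univ]⟩
  · refine MeasurableSpace.generateFrom_le ?_
    rintro _ ⟨B, C, hB, hC, rfl⟩
    exact MeasurableSet.inter (history_mono slice t.le_succ _ hB)
      (measurable_observation slice t.lt_succ_self hC)

/-- The log-likelihood ratio of the models `l` and `l'` at one observation. -/
noncomputable def observationLLR (E : ExpFamily) (l l' : Fin K → ℝ) (p : Fin K × ℝ) : ℝ :=
  E.logLikelihoodRatio (l p.1) (l' p.1) p.2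

@[fun_prop]
theorem measurable_observationLLR (l l' : Fin K → ℝ) : Measurable (observationLLR E l l') :=
  measurable_from_prod_countable_right fun k => measurable_logLikelihoodRatio (l k) (l' k)

/-- The log-likelihood ratio of the models `l` and `l'` at the first `t` observations. -/
noncomputable def historyLLR (E : ExpFamily) (slice : ℕ → Outcome K → Fin K) (l l' : Fin K → ℝ)
    (t : ℕ) (ω : Outcome K) : ℝ :=
  ∑ s ∈ Finset.range t, observationLLR E l l' (observation slice s ω)

theorem measurable_historyLLR (slice : ℕ → Outcome K → Fin K) (l l' : Fin K → ℝ) (t : ℕ) :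
    Measurable[history slice t] (historyLLR E slice l l' t) :=
  Finset.measurable_fun_sum _ fun _ hs => (measurable_observationLLR l l').comp
    (measurable_observation slice (Finset.mem_range.1 hs))

theorem ofReal_exp_neg_historyLLR_succ (l l' : Fin K → ℝ) (t : ℕ) (ω : Outcome K) :
    ENNReal.ofReal (Real.exp (-historyLLR E slice l l' (t + 1) ω))
      = ENNReal.ofReal (Real.exp (-historyLLR E slice l l' t ω))
        * ENNReal.ofReal (Real.exp (-observationLLR E l l' (observation slice t ω))) := by
  rw [← ENNReal.ofReal_mul (Real.exp_pos _).le, ← Real.exp_add, historyLLR,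
    Finset.sum_range_succ, neg_add, historyLLR]

theorem outcomeMeasure_rectangle (h : ∀ t, Measurable[history slice t] (slice t))
    (hl : ∀ k, l k ∈ E.means) (hl' : ∀ k, l' k ∈ E.means)
    (ih : ∀ B, MeasurableSet[history slice t] B → outcomeMeasure E l' B
      = ∫⁻ ω in B, ENNReal.ofReal (Real.exp (-historyLLR E slice l l' t ω)) ∂(outcomeMeasure E l))
    {A : Set (Outcome K)} (hA : A ∈ historyRectangles slice t) :
    outcomeMeasure E l' A = ∫⁻ ω in A,
      ENNReal.ofReal (Real.exp (-historyLLR E slice l l' (t + 1) ω)) ∂(outcomeMeasure E l) := by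
  obtain ⟨B, C, hB, hC, rfl⟩ := hA
  have hLLR : Measurable[history slice t] fun ω =>
      ENNReal.ofReal (Real.exp (-historyLLR E slice l l' t ω)) :=
    ENNReal.measurable_ofReal.comp
      (Real.measurable_exp.comp (measurable_historyLLR slice l l' t).neg)
  have hsplit := setLIntegral_mul_observation (E := E) h l' (f := fun _ => 1) (g := fun _ => 1)
    (@measurable_const _ _ _ (history slice t) 1) measurable_const hB hC
  simp only [mul_one, setLIntegral_one] at hsplit
  simp only [ofReal_exp_neg_historyLLR_succ]
  rw [setLIntegral_mul_observation h l hLLR (g := fun p =>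
    ENNReal.ofReal (Real.exp (-observationLLR E l l' p))) (by fun_prop) hB hC, hsplit]
  refine Finset.sum_congr rfl fun k _ => ?_
  rw [ih _ (measurableSet_inter_slice_eq h hB k), law_eq_withDensity (hl k) (hl' k),
    withDensity_apply _ (measurable_prodMk_left hC)]
  rfl

theorem outcomeMeasure_eq_setLIntegral_historyLLR
    (h : ∀ t, Measurable[history slice t] (slice t)) (hl : ∀ k, l k ∈ E.means)
    (hl' : ∀ k, l' k ∈ E.means) (hB : MeasurableSet[history slice t] B) :
    outcomeMeasure E l' B
      = ∫⁻ ω in B, ENNReal.ofReal (Real.exp (-historyLLR E slice l l' t ω))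
          ∂(outcomeMeasure E l) := by
  induction t generalizing B with
  | zero =>
    rw [history, iSup_of_empty, MeasurableSpace.measurableSet_bot_iff] at hB
    rcases hB with rfl | rfl <;> simp [historyLLR]
  | succ t ih =>
    have hle := history_le slice h (t + 1)
    have hrect : ∀ A ∈ historyRectangles slice t, outcomeMeasure E l' A
        = (outcomeMeasure E l).withDensity (fun ω => ENNReal.ofReal
            (Real.exp (-historyLLR E slice l l' (t + 1) ω))) A := fun A hA => by
      rw [outcomeMeasure_rectangle h hl hl' (fun _ => ih) hA, withDensity_apply]
      refine hle _ ?_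
      rw [history_succ_eq_generateFrom]
      exact MeasurableSpace.measurableSet_generateFrom hA
    rw [← withDensity_apply _ (hle _ hB)]
    refine ext_on_measurableSpace_of_generate_finite _ _ hrect hle
      (history_succ_eq_generateFrom slice t) (isPiSystem_historyRectangles slice t) ?_ hB
    exact hrect _ ⟨Set.univ, Set.univ, MeasurableSet.univ, MeasurableSet.univ, by simp⟩

end ChangeOfMeasure

section DonskerVaradhan

variable {Ω : Type*} [MeasurableSpace Ω] {P P' : Measure Ω} {L : Ω → ℝ} {C : Set Ω}

theorem lintegral_exp_indicator_sub (hC : MeasurableSet C)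
    (hPC : P' C = ∫⁻ ω in C, ENNReal.ofReal (Real.exp (-L ω)) ∂P)
    (hPCc : P' Cᶜ = ∫⁻ ω in Cᶜ, ENNReal.ofReal (Real.exp (-L ω)) ∂P) (c : ℝ) :
    ∫⁻ ω, ENNReal.ofReal (Real.exp (C.indicator (fun _ => c) ω - L ω)) ∂P
      = ENNReal.ofReal (Real.exp c) * P' C + P' Cᶜ := by
  rw [← lintegral_add_compl _ hC, hPC, hPCc, ← lintegral_const_mul' _ _ ENNReal.ofReal_ne_top]
  congr 1
  · refine setLIntegral_congr_fun hC fun ω hω => ?_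
    simp only [Set.indicator_of_mem hω]
    rw [← ENNReal.ofReal_mul (Real.exp_pos _).le, ← Real.exp_add, sub_eq_add_neg]
  · refine setLIntegral_congr_fun hC.compl fun ω hω => ?_
    simp only [Set.indicator_of_notMem hω, zero_sub]

theorem mul_measureReal_sub_log_le_integral [IsProbabilityMeasure P] [IsProbabilityMeasure P']
    (hL : Integrable L P) (hC : MeasurableSet C)
    (hPC : P' C = ∫⁻ ω in C, ENNReal.ofReal (Real.exp (-L ω)) ∂P)
    (hPCc : P' Cᶜ = ∫⁻ ω in Cᶜ, ENNReal.ofReal (Real.exp (-L ω)) ∂P) (c : ℝ) :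
    c * P.real C - Real.log (1 + (Real.exp c - 1) * P'.real C) ≤ ∫ ω, L ω ∂P := by
  have hind : Integrable (C.indicator fun _ => c) P := (integrable_const c).indicator hC
  have hφ : Integrable (fun ω => C.indicator (fun _ => c) ω - L ω) P := hind.sub hL
  have hlint := lintegral_exp_indicator_sub hC hPC hPCc c
  have hexp : Integrable (fun ω => Real.exp (C.indicator (fun _ => c) ω - L ω)) P := by
    refine ⟨Real.continuous_exp.comp_aestronglyMeasurable hφ.1, ?_⟩
    rw [hasFiniteIntegral_iff_ofReal (ae_of_all _ fun ω => (Real.exp_pos _).le), hlint]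
    finiteness
  have hint : ∫ ω, Real.exp (C.indicator (fun _ => c) ω - L ω) ∂P
      = 1 + (Real.exp c - 1) * P'.real C := by
    rw [integral_eq_lintegral_of_nonneg_ae (ae_of_all _ fun ω => (Real.exp_pos _).le) hexp.1,
      hlint, ENNReal.toReal_add (by finiteness) (by finiteness), ENNReal.toReal_mul,
      ENNReal.toReal_ofReal (Real.exp_pos _).le, ← measureReal_def, ← measureReal_def,
      probReal_compl_eq_one_sub hC]
    ring
  have hjensen : Real.exp (∫ ω, C.indicator (fun _ => c) ω - L ω ∂P)
      ≤ 1 + (Real.exp c - 1) * P'.real C :=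
    hint ▸ convexOn_exp.map_integral_le Real.continuous_exp.continuousOn isClosed_univ (by simp)
      hφ hexp
  have hlog := (Real.le_log_iff_exp_le ((Real.exp_pos _).trans_le hjensen)).2 hjensen
  rw [integral_sub hind hL, integral_indicator_const c hC, smul_eq_mul, mul_comm] at hlog
  linarith

end DonskerVaradhan

section Stopping

open ExpFamily

theorem measure_eq_tsum_inter_eq {Ω : Type*} {m : MeasurableSpace Ω} {F : Filtration ℕ m}
    {σ : Ω → ℕ∞} (hσ : IsStoppingTime F σ) {C : Set Ω} (hC : MeasurableSet[hσ.measurableSpace] C)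
    (htop : ∀ ω ∈ C, σ ω ≠ ⊤) (P : Measure Ω) :
    P C = ∑' t : ℕ, P (C ∩ {ω | σ ω = t}) := by
  have hU : C = ⋃ t : ℕ, C ∩ {ω | σ ω = t} := by
    ext ω
    simp only [Set.mem_iUnion, Set.mem_inter_iff, Set.mem_ofPred_eq, exists_and_left]
    exact ⟨fun hω => ⟨hω, (ENat.ne_top_iff_exists.1 (htop ω hω)).imp fun _ ht => ht.symm⟩,
      fun hω => hω.1⟩
  conv_lhs => rw [hU]
  refine measure_iUnion (fun s t hst => Set.disjoint_left.2 fun ω hs ht => hst ?_) fun t => ?_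
  · exact_mod_cast (show (s : ℕ∞) = t from hs.2.symm.trans ht.2)
  · exact hσ.measurableSpace_le _ (MeasurableSet.inter hC (hσ.measurableSet_eq_of_countable' t))

variable {E : ExpFamily} {K : ℕ} {slice : ℕ → Outcome K → Fin K}
  {h : ∀ t, Measurable[history slice t] (slice t)} {l l' : Fin K → ℝ} {σ : Outcome K → ℕ∞}
  {C : Set (Outcome K)} {N : ℕ}

theorem outcomeMeasure_eq_setLIntegral_stoppedValue (hl : ∀ k, l k ∈ E.means)
    (hl' : ∀ k, l' k ∈ E.means) (hσ : IsStoppingTime (historyFiltration slice h) σ)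
    (hC : MeasurableSet[hσ.measurableSpace] C) (htop : ∀ ω ∈ C, σ ω ≠ ⊤) :
    outcomeMeasure E l' C = ∫⁻ ω in C,
      ENNReal.ofReal (Real.exp (-stoppedValue (historyLLR E slice l l') σ ω))
        ∂(outcomeMeasure E l) := by
  rw [← withDensity_apply' _ C, measure_eq_tsum_inter_eq hσ hC htop,
    measure_eq_tsum_inter_eq hσ hC htop]
  refine tsum_congr fun t => ?_
  have hCt : MeasurableSet[history slice t] (C ∩ {ω | σ ω = t}) :=
    (hσ.measurableSet_inter_eq_iff C t).1
      (MeasurableSet.inter hC (hσ.measurableSet_eq_of_countable' t))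
  rw [withDensity_apply' _ (C ∩ _), outcomeMeasure_eq_setLIntegral_historyLLR h hl hl' hCt]
  refine setLIntegral_congr_fun (history_le slice h t _ hCt) fun ω hω => ?_
  simp [stoppedValue, show σ ω = t from hω.2]

theorem integrable_observationLLR (h : ∀ t, Measurable[history slice t] (slice t))
    (hl : ∀ k, l k ∈ E.means) (l' : Fin K → ℝ) (t : ℕ) :
    Integrable (fun ω => observationLLR E l l' (observation slice t ω)) (outcomeMeasure E l) := by
  refine Integrable.mono' (integrable_finsetSum Finset.univ fun k _ =>
    ((measurePreserving_outcome l t k).integrable_comp_of_integrable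
      (integrable_logLikelihoodRatio (hl k) (l' k))).norm)
    ((measurable_observationLLR l l').comp ((measurable_observation slice t.lt_succ_self).mono
      (history_le slice h _) le_rfl)).aestronglyMeasurable (ae_of_all _ fun ω => ?_)
  exact Finset.single_le_sum
    (f := fun k => ‖E.logLikelihoodRatio (l k) (l' k) (ω t k)‖) (fun k _ => norm_nonneg _)
    (Finset.mem_univ (slice t ω))

theorem setIntegral_observationLLR (h : ∀ t, Measurable[history slice t] (slice t))
    (hl : ∀ k, l k ∈ E.means) (hl' : ∀ k, l' k ∈ E.means) {t : ℕ}
    (hC : MeasurableSet[history slice t] C) :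
    ∫ ω in C, observationLLR E l l' (observation slice t ω) ∂(outcomeMeasure E l)
      = ∑ k, (outcomeMeasure E l).real (C ∩ {ω | slice t ω = k}) * E.d (l k) (l' k) := by
  have hle := history_le slice h t
  have hCk := measurableSet_inter_slice_eq h hC
  conv_lhs => rw [← iUnion_inter_slice_eq (slice := slice) C t]
  rw [integral_iUnion_fintype (fun k => hle _ (hCk k)) (pairwise_disjoint_inter_slice_eq C t)
    fun k => (integrable_observationLLR h hl l' t).integrableOn]
  refine Finset.sum_congr rfl fun k _ => ?_
  have hmp := measurePreserving_outcome (E := E) l t k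
  have hLR := measurable_logLikelihoodRatio (E := E) (l k) (l' k)
  calc ∫ ω in C ∩ {ω | slice t ω = k}, observationLLR E l l' (observation slice t ω)
        ∂(outcomeMeasure E l)
      = ∫ ω in C ∩ {ω | slice t ω = k}, E.logLikelihoodRatio (l k) (l' k) (ω t k)
        ∂(outcomeMeasure E l) := setIntegral_congr_fun (hle _ (hCk k)) fun ω hω => by
          obtain ⟨-, rfl⟩ := hω
          rfl
    _ = _ := (indep_history h l t k).setIntegral_eq_mul hle hmp.measurable.aemeasurable (hCk k)
          hLR.aestronglyMeasurable
    _ = _ := by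
      rw [← integral_map hmp.measurable.aemeasurable hLR.aestronglyMeasurable, hmp.map_eq,
        integral_logLikelihoodRatio (hl k) (hl' k)]

/-- The expected number of slots `s < N` preceding `σ` in which slice `k` is measured. -/
noncomputable def expectedCount (E : ExpFamily) (slice : ℕ → Outcome K → Fin K) (l : Fin K → ℝ)
    (σ : Outcome K → ℕ∞) (N : ℕ) (k : Fin K) : ℝ :=
  ∑ s ∈ Finset.range N, (outcomeMeasure E l).real ({ω | s < σ ω} ∩ {ω | slice s ω = k})

theorem expectedCount_nonneg (k : Fin K) : 0 ≤ expectedCount E slice l σ N k :=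
  Finset.sum_nonneg fun _ _ => measureReal_nonneg

theorem stoppedValue_historyLLR (l l' : Fin K → ℝ) (hσN : ∀ ω, σ ω ≤ N) (ω : Outcome K) :
    stoppedValue (historyLLR E slice l l') σ ω = ∑ s ∈ Finset.range N,
      {ω | s < σ ω}.indicator (fun ω => observationLLR E l l' (observation slice s ω)) ω := by
  obtain ⟨t, ht⟩ := ENat.ne_top_iff_exists.1 (ne_top_of_le_ne_top (ENat.natCast_ne_top N) (hσN ω))
  have htN : t ≤ N := by exact_mod_cast ht ▸ hσN ω
  simp only [Set.indicator_apply, Set.mem_ofPred_eq, stoppedValue, ← ht, Nat.cast_lt,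
    ← Finset.sum_filter]
  refine Finset.sum_congr ?_ fun _ _ => rfl
  ext s
  simp
  omega

theorem integral_stoppedValue_historyLLR (hl : ∀ k, l k ∈ E.means) (hl' : ∀ k, l' k ∈ E.means)
    (hσ : IsStoppingTime (historyFiltration slice h) σ) (hσN : ∀ ω, σ ω ≤ N) :
    ∫ ω, stoppedValue (historyLLR E slice l l') σ ω ∂(outcomeMeasure E l)
      = ∑ k, expectedCount E slice l σ N k * E.d (l k) (l' k) := by
  have hlt : ∀ s : ℕ, MeasurableSet[history slice s] {ω | s < σ ω} := hσ.measurableSet_gt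
  have hlt' := fun s => history_le slice h s _ (hlt s)
  simp only [stoppedValue_historyLLR l l' hσN]
  rw [integral_finsetSum _ fun s _ => (integrable_observationLLR h hl l' s).indicator (hlt' s)]
  simp only [expectedCount, Finset.sum_mul]
  rw [Finset.sum_comm]
  refine Finset.sum_congr rfl fun s _ => ?_
  rw [integral_indicator (hlt' s), setIntegral_observationLLR h hl hl' (hlt s)]

theorem sum_expectedCount (hσ : IsStoppingTime (historyFiltration slice h) σ) :
    ∑ k, expectedCount E slice l σ N k
      = ∑ s ∈ Finset.range N, (outcomeMeasure E l).real {ω | s < σ ω} := by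
  simp only [expectedCount]
  rw [Finset.sum_comm]
  refine Finset.sum_congr rfl fun s _ => ?_
  have hC := hσ.measurableSet_gt s
  have hCk := fun k => history_le slice h s _ (measurableSet_inter_slice_eq h hC k)
  have hunion := iUnion_inter_slice_eq (slice := slice) {ω | s < σ ω} s
  have hsum := measureReal_iUnion_fintype (μ := outcomeMeasure E l)
    (pairwise_disjoint_inter_slice_eq _ s) hCk
  exact hsum.symm.trans (congrArg _ hunion)

theorem sum_range_indicator_lt_le (n : ℕ∞) (N : ℕ) :
    (∑ s ∈ Finset.range N, if (s : ℕ∞) < n then (1 : ENNReal) else 0) ≤ n := by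
  cases n with
  | top => simp
  | coe m =>
    simp only [Nat.cast_lt, Finset.sum_boole, ENat.toENNReal_coe]
    have hsub : (Finset.range N).filter (· < m) ⊆ Finset.range m := fun s hs =>
      Finset.mem_range.2 (Finset.mem_filter.1 hs).2
    exact_mod_cast (Finset.card_le_card hsub).trans_eq (Finset.card_range m)

theorem ofReal_sum_expectedCount_le (hσ : IsStoppingTime (historyFiltration slice h) σ) :
    ENNReal.ofReal (∑ k, expectedCount E slice l σ N k)
      ≤ ∫⁻ ω, (σ ω : ENNReal) ∂(outcomeMeasure E l) := by
  have hlt : ∀ s : ℕ, MeasurableSet {ω | s < σ ω} := fun s =>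
    history_le slice h s _ (hσ.measurableSet_gt s)
  calc ENNReal.ofReal (∑ k, expectedCount E slice l σ N k)
      = ∑ s ∈ Finset.range N, outcomeMeasure E l {ω | s < σ ω} := by
        rw [sum_expectedCount hσ, ENNReal.ofReal_sum_of_nonneg fun _ _ => measureReal_nonneg]
        exact Finset.sum_congr rfl fun s _ => ofReal_measureReal
    _ = ∫⁻ ω, ∑ s ∈ Finset.range N, {ω | s < σ ω}.indicator 1 ω ∂(outcomeMeasure E l) := by
        rw [lintegral_finsetSum _ fun s _ => measurable_one.indicator (hlt s)]
        exact Finset.sum_congr rfl fun s _ => (lintegral_indicator_one (hlt s)).symm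
    _ ≤ ∫⁻ ω, (σ ω : ENNReal) ∂(outcomeMeasure E l) :=
        lintegral_mono fun ω => by
          simpa only [Set.indicator_apply, Set.mem_ofPred_eq, Pi.one_apply]
            using sum_range_indicator_lt_le (σ ω) N

theorem mul_measureReal_sub_log_le_expectedCount (hl : ∀ k, l k ∈ E.means)
    (hl' : ∀ k, l' k ∈ E.means) (hσ : IsStoppingTime (historyFiltration slice h) σ)
    (hσN : ∀ ω, σ ω ≤ N) (hC : MeasurableSet[hσ.measurableSpace] C) (c : ℝ) :
    c * (outcomeMeasure E l).real C
        - Real.log (1 + (Real.exp c - 1) * (outcomeMeasure E l').real C)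
      ≤ ∑ k, expectedCount E slice l σ N k * E.d (l k) (l' k) := by
  have htop : ∀ ω, σ ω ≠ ⊤ := fun ω => ne_top_of_le_ne_top (ENat.natCast_ne_top N) (hσN ω)
  have hint : Integrable (stoppedValue (historyLLR E slice l l') σ) (outcomeMeasure E l) :=
    integrable_stoppedValue ℕ hσ (fun n => integrable_finsetSum _ fun s _ =>
      integrable_observationLLR h hl l' s) hσN
  rw [← integral_stoppedValue_historyLLR hl hl' hσ hσN]
  exact mul_measureReal_sub_log_le_integral hint (hσ.measurableSpace_le _ hC)
    (outcomeMeasure_eq_setLIntegral_stoppedValue hl hl' hσ hC fun ω _ => htop ω)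
    (outcomeMeasure_eq_setLIntegral_stoppedValue hl hl' hσ (MeasurableSet.compl hC)
      fun ω _ => htop ω) c

end Stopping

section Bernoulli

open unitInterval

variable {p q : unitInterval}

theorem bernoulliMeasure_eq_withDensity {X : Type*} [MeasurableSpace X]
    [MeasurableSingletonClass X] (x y : X) {g : X → ENNReal} (hx : toNNReal p = toNNReal q * g x)
    (hy : toNNReal (σ p) = toNNReal (σ q) * g y) :
    bernoulliMeasure x y p = (bernoulliMeasure x y q).withDensity g := by
  have hsmul (r : NNReal) (m : Measure X) : r • m = (r : ENNReal) • m := rfl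
  simp only [bernoulliMeasure_def, hsmul, withDensity_add_measure, withDensity_smul_measure,
    dirac_withDensity, smul_smul, hx, hy]

/-- The log-likelihood ratio of the Bernoulli laws with means `p` and `q`, interpolated affinely
between its values at the atoms `1` and `0`. -/
noncomputable def bernoulliLLR (p q : unitInterval) (x : ℝ) : ℝ :=
  x * Real.log (p / q) + (1 - x) * Real.log ((1 - p) / (1 - q))

theorem mul_exp_bernoulliLLR_one (hp : 0 < p) (hq : 0 < q) :
    q * Real.exp (bernoulliLLR p q 1) = p := by
  have hp' : (0 : ℝ) < p := hp
  have hq' : (0 : ℝ) < q := hq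
  rw [bernoulliLLR, one_mul, sub_self, zero_mul, add_zero, Real.exp_log (div_pos hp' hq'),
    mul_div_cancel₀ _ hq'.ne']

theorem mul_exp_bernoulliLLR_zero (hp : p < 1) (hq : q < 1) :
    (1 - q) * Real.exp (bernoulliLLR p q 0) = 1 - p := by
  have hp' : 0 < 1 - (p : ℝ) := sub_pos.2 hp
  have hq' : 0 < 1 - (q : ℝ) := sub_pos.2 hq
  rw [bernoulliLLR, zero_mul, sub_zero, zero_add, one_mul, Real.exp_log (div_pos hp' hq'),
    mul_div_cancel₀ _ hq'.ne']

theorem integral_exp_bernoulliLLR (hp : p ∈ Set.Ioo 0 1) (hq : q ∈ Set.Ioo 0 1) :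
    ∫ x, Real.exp (bernoulliLLR p q x) ∂(bernoulliMeasure (1 : ℝ) 0 q) = 1 := by
  rw [integral_bernoulliMeasure, smul_eq_mul, smul_eq_mul, mul_exp_bernoulliLLR_one hp.1 hq.1,
    mul_exp_bernoulliLLR_zero hp.2 hq.2, add_sub_cancel]

theorem bernoulliMeasure_eq_tilted (hp : p ∈ Set.Ioo 0 1) (hq : q ∈ Set.Ioo 0 1) :
    bernoulliMeasure (1 : ℝ) 0 p = (bernoulliMeasure 1 0 q).tilted (bernoulliLLR p q) := by
  rw [Measure.tilted, integral_exp_bernoulliLLR hp hq]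
  refine bernoulliMeasure_eq_withDensity 1 0 ?_ ?_ <;>
    rw [div_one, ← ENNReal.ofReal_coe_nnreal, ← ENNReal.ofReal_coe_nnreal,
      ← ENNReal.ofReal_mul (NNReal.coe_nonneg _), coe_toNNReal, coe_toNNReal]
  · rw [mul_exp_bernoulliLLR_one hp.1 hq.1]
  · rw [coe_symm_eq, coe_symm_eq, mul_exp_bernoulliLLR_zero hp.2 hq.2]

theorem bernoulliKL_eq (hp : p ∈ Set.Ioo 0 1) (hq : q ∈ Set.Ioo 0 1) :
    bernoulliKL p q = p * Real.log (p / q) + (1 - p) * Real.log ((1 - p) / (1 - q)) := by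
  have hKL := toReal_klDiv_tilted_left_self (f := bernoulliLLR p q)
    (integrable_bernoulliMeasure (1 : ℝ) 0 q _)
    (bernoulliMeasure_eq_tilted hp hq ▸ integrable_bernoulliMeasure _ _ _ _)
  rw [← bernoulliMeasure_eq_tilted hp hq, integral_exp_bernoulliLLR hp hq,
    integral_bernoulliMeasure] at hKL
  simpa [bernoulliKL, bernoulliLLR] using hKL

theorem bernoulliKL_symm (hp : p ∈ Set.Ioo 0 1) :
    bernoulliKL p (σ p) = (1 - 2 * p) * Real.log ((1 - p) / p) := by
  have hσ : σ p ∈ Set.Ioo 0 1 :=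
    ⟨lt_symm_comm.1 (symm_zero.symm ▸ hp.2), symm_lt_comm.1 (symm_one.symm ▸ hp.1)⟩
  rw [bernoulliKL_eq hp hσ, coe_symm_eq, sub_sub_cancel, ← inv_div (1 - (p : ℝ)), Real.log_inv]
  ring

end Bernoulli

section LowerBound

open Filter Topology

theorem iUnion_le_natCast_eq_lt_top {Ω : Type*} (σ : Ω → ℕ∞) :
    ⋃ n : ℕ, {ω | σ ω ≤ n} = {ω | σ ω < ⊤} := by
  ext ω
  simp only [Set.mem_iUnion, Set.mem_ofPred_eq]
  exact ⟨fun ⟨n, hn⟩ => hn.trans_lt (ENat.natCast_lt_top n),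
    fun hω => (ENat.ne_top_iff_exists.1 hω.ne).imp fun _ hn => hn.ge⟩

theorem tendsto_measureReal_inter_le_natCast {Ω : Type*} {m : MeasurableSpace Ω}
    {F : Filtration ℕ m} {σ : Ω → ℕ∞} (hσ : IsStoppingTime F σ) {P : Measure Ω}
    [IsProbabilityMeasure P] (hfin : P {ω | σ ω < ⊤} = 1) (D : Set Ω) :
    Tendsto (fun n : ℕ => P.real (D ∩ {ω | σ ω ≤ n})) atTop (𝓝 (P.real D)) := by
  have hmono : Monotone fun n : ℕ => D ∩ {ω | σ ω ≤ n} := fun i j hij =>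
    Set.inter_subset_inter_right _ fun ω (hω : σ ω ≤ i) => hω.trans (Nat.cast_le.2 hij)
  have hmeas : MeasurableSet {ω | σ ω < ⊤} :=
    iUnion_le_natCast_eq_lt_top σ ▸ MeasurableSet.iUnion fun n => F.le n _ (hσ n)
  have hlim := tendsto_measure_iUnion_atTop (μ := P) hmono
  rw [← Set.inter_iUnion, iUnion_le_natCast_eq_lt_top,
    measure_inter_conull ((prob_compl_eq_zero_iff hmeas).2 hfin)] at hlim
  exact (ENNReal.tendsto_toReal (measure_ne_top _ _)).comp hlim

variable {E : ExpFamily} {K : ℕ} {γ δ : ℝ} {μ : Fin K → ℝ} {k₀ : Fin K} {a : Option (Fin K)}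
  {A : Algorithm K}

theorem Algorithm.IsPC.measureReal_decision_le (hA : A.IsPC E γ δ) (hδ : 0 ≤ δ) {l : Fin K → ℝ}
    (hl : l ∈ alternatives E K γ a) :
    (outcomeMeasure E l).real {ω | A.decision ω = a} ≤ δ := by
  refine ENNReal.toReal_le_of_le_ofReal hδ ((measure_mono ?_).trans (hA l hl.1).2)
  rintro ω rfl
  exact hl.2

theorem Algorithm.IsPC.one_sub_le_measureReal_decision (hA : A.IsPC E γ δ) (hδ : 0 ≤ δ)
    (hμ : μ ∈ loadModels E K γ) (ha : correctAnswers γ μ ⊆ {a}) :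
    1 - δ ≤ (outcomeMeasure E μ).real {ω | A.decision ω = a} := by
  have herror : (outcomeMeasure E μ).real {ω | A.decision ω = a}ᶜ ≤ δ := by
    refine ENNReal.toReal_le_of_le_ofReal hδ ((measure_mono ?_).trans (hA μ hμ).2)
    exact fun ω hω hmem => hω (ha hmem)
  have hsum := measureReal_union_le (μ := outcomeMeasure E μ) {ω | A.decision ω = a}
    {ω | A.decision ω = a}ᶜ
  rw [Set.union_compl_self, probReal_univ] at hsum
  linarith

/-- The expected number of slots up to time `n` in which the algorithm measures slice `k`. -/
noncomputable def Algorithm.truncatedCount (A : Algorithm K) (E : ExpFamily) (l : Fin K → ℝ)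
    (n : ℕ) (k : Fin K) : ℝ :=
  expectedCount E A.slice l (fun ω => min (A.τ ω) n) n k

theorem Algorithm.ofReal_sum_truncatedCount_le (A : Algorithm K) (n : ℕ) :
    ENNReal.ofReal (∑ k, A.truncatedCount E μ n k) ≤ A.sampleComplexity E μ :=
  (ofReal_sum_expectedCount_le (A.isStoppingTime.min_const n)).trans
    (lintegral_mono fun _ => ENat.toENNReal_mono (min_le_left _ _))

theorem Algorithm.IsPC.mul_sub_log_le_informationRate (hA : A.IsPC E γ δ) (hδ : 0 ≤ δ)
    (hμ : ∀ k, μ k ∈ E.means) (ha : (alternatives E K γ a).Nonempty) {c : ℝ} (hc : 0 ≤ c)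
    (n : ℕ) :
    c * (outcomeMeasure E μ).real ({ω | A.decision ω = a} ∩ {ω | A.τ ω ≤ n})
        - Real.log (1 + (Real.exp c - 1) * δ)
      ≤ informationRate E γ μ a (A.truncatedCount E μ n) := by
  have := ha.to_subtype
  have hexp : 0 ≤ Real.exp c - 1 := sub_nonneg.2 (Real.one_le_exp hc)
  have hmeas : MeasurableSet[(A.isStoppingTime.min_const n).measurableSpace]
      ({ω | A.decision ω = a} ∩ {ω | A.τ ω ≤ n}) :=
    (A.isStoppingTime.measurableSet_inter_le_const_iff _ n).1
      (MeasurableSet.inter (A.measurable_decision (t := {a}) trivial)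
        (A.isStoppingTime.measurableSet_le' n))
  refine le_ciInf fun l => ?_
  refine le_trans ?_ (mul_measureReal_sub_log_le_expectedCount hμ l.2.1.1
    (A.isStoppingTime.min_const n) (fun _ => min_le_right _ _) hmeas c)
  have hδl : (outcomeMeasure E l.1).real ({ω | A.decision ω = a} ∩ {ω | A.τ ω ≤ n}) ≤ δ :=
    (measureReal_mono Set.inter_subset_left).trans (hA.measureReal_decision_le hδ l.2)
  gcongr

theorem IsOptimalLevel.ofReal_mul_sub_log_mul_characteristicTime_le {z : ℝ}
    (h : IsOptimalLevel E γ μ k₀ z) (hμ : μ ∈ loadModels E K γ) (hγ : γ ∈ E.means)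
    (hmin : ∀ j, j ≠ k₀ → μ k₀ < μ j) (ha : correctAnswers γ μ ⊆ {some k₀}) (hδ : 0 ≤ δ)
    (hA : A.IsPC E γ δ) {c : ℝ} (hc : 0 ≤ c) :
    ENNReal.ofReal ((c * (1 - δ) - Real.log (1 + (Real.exp c - 1) * δ))
        * characteristicTime E μ k₀ z)
      ≤ A.sampleComplexity E μ := by
  have hT := (h.characteristicTime_pos hμ.1 hmin).le
  have hlim := ENNReal.tendsto_ofReal ((((tendsto_measureReal_inter_le_natCast A.isStoppingTime
    (hA μ hμ).1 {ω | A.decision ω = some k₀}).const_mul c).sub_const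
    (Real.log (1 + (Real.exp c - 1) * δ))).mul_const (characteristicTime E μ k₀ z))
  refine (ENNReal.ofReal_le_ofReal ?_).trans (le_of_tendsto' hlim fun n => ?_)
  · gcongr
    exact hA.one_sub_le_measureReal_decision hδ hμ ha
  · refine (ENNReal.ofReal_le_ofReal ?_).trans (A.ofReal_sum_truncatedCount_le n)
    refine le_trans ?_ (h.informationRate_mul_characteristicTime_le hμ.1 hγ hmin fun k => ?_)
    · gcongr
      exact hA.mul_sub_log_le_informationRate hδ hμ.1 (alternatives_nonempty hμ.1 hγ k₀) hc n
    · exact expectedCount_nonneg k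

-- This `c` maximizes the right-hand side: it is the optimal choice in the Donsker–Varadhan bound.
theorem bernoulliKL_symm_eq_mul_sub_log {p : unitInterval} (hp : p ∈ Set.Ioo 0 1) {c : ℝ}
    (hc : c = 2 * Real.log ((1 - p) / p)) :
    bernoulliKL p (unitInterval.symm p)
      = c * (1 - p) - Real.log (1 + (Real.exp c - 1) * p) := by
  have hp₀ : (0 : ℝ) < p := hp.1
  have hp₁ : 0 < 1 - (p : ℝ) := sub_pos.2 hp.2
  have hexp : 1 + (Real.exp c - 1) * p = (1 - p) / p := by
    rw [hc, two_mul, Real.exp_add, Real.exp_log (div_pos hp₁ hp₀)]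
    field_simp
    ring
  rw [bernoulliKL_symm hp, hexp, hc]
  ring

theorem IsOptimalLevel.le_sampleComplexity {z : ℝ} (h : IsOptimalLevel E γ μ k₀ z)
    (hμ : μ ∈ loadModels E K γ) (hγ : γ ∈ E.means) (hmin : ∀ j, j ≠ k₀ → μ k₀ < μ j)
    (ha : correctAnswers γ μ ⊆ {some k₀}) {p : unitInterval} (hp : 0 < p)
    (hp₂ : (p : ℝ) ≤ 1 / 2) (hA : A.IsPC E γ p) :
    ENNReal.ofReal (characteristicTime E μ k₀ z * bernoulliKL p (unitInterval.symm p))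
      ≤ A.sampleComplexity E μ := by
  have hp₀ : (0 : ℝ) < p := hp
  have hp₁ : p < 1 := show (p : ℝ) < 1 by linarith
  have hc : 0 ≤ 2 * Real.log ((1 - p) / p) :=
    mul_nonneg zero_le_two (Real.log_nonneg ((one_le_div hp₀).2 (by linarith)))
  rw [mul_comm, bernoulliKL_symm_eq_mul_sub_log ⟨hp, hp₁⟩ rfl]
  exact h.ofReal_mul_sub_log_mul_characteristicTime_le hμ hγ hmin ha hp₀.le hA hc

end LowerBound

theorem proposition4 (E : ExpFamily) (K : ℕ) (hK : 2 ≤ K)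
    (γ : ℝ) (hγ : γ ∈ E.means)
    (μ : Fin K → ℝ) (hμ : μ ∈ loadModels E K γ)
    (havail : correctAnswers γ μ ≠ {none})
    (k₀ : Fin K) (hk₀ : ∀ j, μ k₀ ≤ μ j) :
    (∃! y : ℝ, IsEquilibrium E μ k₀ (moreLoaded μ k₀) y) ∧
    ∀ y z : ℝ, IsEquilibrium E μ k₀ (moreLoaded μ k₀) y → z = min (E.d (μ k₀) γ) y →
      (∀ δ : unitInterval, 0 < δ → (δ : ℝ) ≤ 1 / 2 →
        ∀ A : Algorithm K, A.IsPC E γ δ →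
          ENNReal.ofReal (characteristicTime E μ k₀ z * bernoulliKL δ (unitInterval.symm δ))
            ≤ A.sampleComplexity E μ) ∧
      proportions E μ k₀ z ∈ stdSimplex ℝ (Fin K) ∧
      informationRate E γ μ (some k₀) (proportions E μ k₀ z)
        = (characteristicTime E μ k₀ z)⁻¹ ∧
      ∀ w ∈ stdSimplex ℝ (Fin K), w ≠ proportions E μ k₀ z →
        informationRate E γ μ (some k₀) w
          < informationRate E γ μ (some k₀) (proportions E μ k₀ z) := by
  have hmin : ∀ j, j ≠ k₀ → μ k₀ < μ j := fun j => lt_of_ne_of_mem_loadModels hμ hk₀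
  have hγ₀ : μ k₀ < γ := lt_of_not_ge fun hle =>
    havail (correctAnswers_eq_singleton_none fun k => hle.trans (hk₀ k))
  have hne := moreLoaded_nonempty hK hmin
  refine ⟨existsUnique_isEquilibrium hne (hμ.1 k₀) fun j hj => ⟨hμ.1 j, mem_moreLoaded.1 hj⟩, ?_⟩
  rintro y z hy rfl
  have hz := hy.isOptimalLevel_min hμ.1 hγ hγ₀.ne hne
  have ha := correctAnswers_subset_singleton_some hγ₀ hmin
  have hrate := hz.informationRate_proportions hμ.1 hγ hmin hγ₀.le
  exact ⟨fun δ hδ hδ₂ A hA => hz.le_sampleComplexity hμ hγ hmin ha hδ hδ₂ hA,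
    hz.proportions_mem_stdSimplex hμ.1 hmin, hrate,
    fun w hw hne => hrate ▸ hz.informationRate_lt hμ.1 hγ hmin hw hne⟩
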